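/- Let $V>0$ and $\mathbb{R}^+=[0,\infty)$, and assume: **(v)** $v\in C^{0,1}([0,1];[0,V])$, $v(1)=0$, $v$ is non-increasing, $r\mapsto r\,v(r)$ is strictly concave, and for every $w>0$ the map $r\mapsto \frac{r\,w\,v(r)}{w+v(r)}$ is strictly concave on $[0,1]$; **(p)** $p\in C^{1,1}(\mathbb{R}^+;\mathbb{R})$ (i.e. $p\in C^1$ with $\dot p$ Lipschitz), and $\dot p\ge 0$ a.e.; **($\chi$)** $\chi\in C^1_c(\mathbb{R};[0,1])$. Let $f(t,x,r)=r\,\mathcal V(t,x,r)$, where $$\mathcal V(t,x,r)=\chi(x-p(t))\,\frac{2\dot p(t)v(r)}{\dot p(t)+v(r)}+\bigl(1-\chi(x-p(t))\bigr)v(r)$$ if $(\dot p(t),v(r))\ne(0,0)$, and $\mathcal V(t,x,r)=0$ otherwise. For $\rho_o\in L^\infty(\mathbb{R};[0,1])$, a Kružkov solution of $$\partial_t\rho+\partial_x f(t,x,\rho)=0,\qquad \rho(0,x)=\rho_o(x)\tag{CP}$$ is a $\rho\in L^\infty(\mathbb{R}^+\times\mathbb{R};[0,1])$ such that for all $k\in[0,1]$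 and all non-negative $\phi\in C_c^\infty((0,\infty)\times\mathbb{R})$ $$\int_0^\infty\!\!\int_{\mathbb{R}}\Bigl[|\rho-k|\,\partial_t\phi+\operatorname{sgn}(\rho-k)\bigl(f(t,x,\rho)-f(t,x,k)\bigr)\partial_x\phi-\operatorname{sgn}(\rho-k)\,\partial_xf(t,x,k)\,\phi\Bigr]\,dx\,dt\ge 0,$$ and such that, for some Lebesgue null set $\mathcal E\subset\mathbb{R}$, $\int_{\mathbb{R}}|\rho(t,x)-\rho_o(x)|\,dx\to0$ as $t\to0+$, $t\notin\mathcal E$. Then: 1. For every $\rho_o\in L^\infty(\mathbb{R};[0,1])$, (CP) has at most one Kružkov solution (up to equality a.e.). 2. There is a finite constant $C\ge0$, depending only on $v,p,\chi$, such that for all $\rho_o,\rho_o'\in L^\infty(\mathbb{R};[0,1])$ and all corresponding Kružkov solutions $\rho,\rho'$ $$\|\rho'(t)-\rho(t)\|_{L^1(\mathbb{R})}\le e^{Ct}\,\|\rho_o'-\rho_o\|_{L^1(\mathbb{R})}\qquad\text{for a.e. }t>0,\tag{Lip}$$ where the norms may be $+\infty$. 3. Let $g(r,q)=\frac{q\,r\,v(r)}{q+v(r)}$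 (and $g(r,q)=0$ where $q=v(r)=0$). Suppose that $\mathbf{Lip}(\chi)$, $\mathbf{Lip}(p)$, $\mathbf{Lip}(\dot p)$, $\mathbf{Lip}(\rho v)$, $\mathbf{Lip}(g)$ are Lipschitz constants of $\chi$ on $\mathbb{R}$, of $p$ and $\dot p$ on $\mathbb{R}^+$, of $r\mapsto r\,v(r)$ on $[0,1]$, and of $g$ on $[0,1]\times[0,\mathbf{Lip}(p)]$ with respect to $|\Delta r|+|\Delta q|$, and that $L\ge0$ satisfies $|g(r_1,\dot p(t))-g(r_2,\dot p(t))|\le\mathbf{Lip}(p)\,L\,|r_1-r_2|$ for all $t\ge0$ and $r_1,r_2\in[0,1]$. (The latter holds in particular if $L$ is a Lipschitz constant of $r\mapsto\frac{r\,v(r)}{\dot p(t)+v(r)}$ on $[0,1]$ for all $t\ge0$.) Then (Lip) holds with $$C=\mathbf{Lip}(\chi)\bigl(1+\mathbf{Lip}(p)\bigr)\bigl(\mathbf{Lip}(p)\,L+\mathbf{Lip}(\rho v)\bigr)+\mathbf{Lip}(g)\,\mathbf{Lip}(\dot p).$$ -/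

import Mathlib

open Set Filter Topology MeasureTheory
open scoped NNReal ENNReal ContDiff

/-- Assumption **(v)** on the speed law `v ∈ C^{0,1}([0,1];[0,V])`; only the values of `v` on
`[0,1]` matter. -/
structure SpeedLaw (V : ℝ) (v : ℝ → ℝ) : Prop where
  lipschitz : ∃ K : ℝ≥0, LipschitzOnWith K v (Icc 0 1)
  mapsTo : MapsTo v (Icc 0 1) (Icc 0 V)
  apply_one : v 1 = 0
  antitone : AntitoneOn v (Icc 0 1)
  strictConcave : StrictConcaveOn ℝ (Icc 0 1) (fun r => r * v r)
  strictConcave_harmonic : ∀ w : ℝ, 0 < w →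
    StrictConcaveOn ℝ (Icc 0 1) (fun r => r * w * v r / (w + v r))

/-- The derivative of a trajectory defined on `[0,∞)` (one-sided at `t = 0`). -/
noncomputable def velocity (p : ℝ → ℝ) (t : ℝ) : ℝ := derivWithin p (Ici 0) t

/-- Assumption **(p)** on the measured trajectory: `p` is `C¹` on `[0,∞)`, with Lipschitz
derivative, and the derivative is non-negative. -/
structure Trajectory (p : ℝ → ℝ) : Prop where
  contDiffOn : ContDiffOn ℝ 1 p (Ici 0)
  lipschitz_velocity : ∃ K : ℝ≥0, LipschitzOnWith K (velocity p) (Ici 0)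
  velocity_nonneg : ∀ᵐ t ∂(volume.restrict (Ici (0 : ℝ))), 0 ≤ velocity p t

/-- Assumption **(χ)** on the interpolating function: `χ ∈ C¹_c(ℝ;[0,1])`. -/
structure CutOff (χ : ℝ → ℝ) : Prop where
  contDiff : ContDiff ℝ 1 χ
  hasCompactSupport : HasCompactSupport χ
  mem_Icc : ∀ x, χ x ∈ Icc (0 : ℝ) 1

/-- The speed law `𝒱(t,x,r)` obtained by interpolating, near `p(t)`, between `v` and the harmonic
mean of `v` and the measured speed. -/
noncomputable def speed (v p χ : ℝ → ℝ) (t x r : ℝ) : ℝ :=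
  if velocity p t = 0 ∧ v r = 0 then 0
  else χ (x - p t) * (2 * velocity p t * v r / (velocity p t + v r))
    + (1 - χ (x - p t)) * v r

/-- The flux `f(t,x,r) = r 𝒱(t,x,r)`. -/
noncomputable def flux (v p χ : ℝ → ℝ) (t x r : ℝ) : ℝ := r * speed v p χ t x r

/-- The open half plane `(0,∞) × ℝ` of the variables `(t,x)`. -/
def halfPlane : Set (ℝ × ℝ) := Ioi 0 ×ˢ univ

/-- (A representative of) an element of `L^∞(ℝ;[0,1])`. -/
structure Datum (ρo : ℝ → ℝ) : Prop where
  aestronglyMeasurable : AEStronglyMeasurable ρo volume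
  mem_Icc : ∀ᵐ x, ρo x ∈ Icc (0 : ℝ) 1

/-- Non-negative test functions in `C_c^∞((0,∞) × ℝ)`. -/
structure KruzkovTest (φ : ℝ × ℝ → ℝ) : Prop where
  contDiff : ContDiff ℝ ∞ φ
  hasCompactSupport : HasCompactSupport φ
  tsupport_subset : tsupport φ ⊆ halfPlane
  nonneg : ∀ z, 0 ≤ φ z

/-- (A representative of) a Kružkov solution `ρ ∈ L^∞(ℝ⁺ × ℝ;[0,1])` of
`∂ₜρ + ∂ₓ f(t,x,ρ) = 0`, `ρ(0,·) = ρo`. The constants `k` range over `[0,1]`, where `f(t,x,·)` is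
defined. -/
structure KruzkovSolution (v p χ : ℝ → ℝ) (ρo : ℝ → ℝ) (ρ : ℝ → ℝ → ℝ) : Prop where
  aestronglyMeasurable :
    AEStronglyMeasurable (fun z : ℝ × ℝ => ρ z.1 z.2) (volume.restrict halfPlane)
  mem_Icc : ∀ᵐ z ∂(volume.restrict halfPlane), ρ z.1 z.2 ∈ Icc (0 : ℝ) 1
  entropy : ∀ k ∈ Icc (0 : ℝ) 1, ∀ φ : ℝ × ℝ → ℝ, KruzkovTest φ →
    0 ≤ ∫ z in halfPlane,
      (|ρ z.1 z.2 - k| * fderiv ℝ φ z (1, 0)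
        + Real.sign (ρ z.1 z.2 - k)
          * (flux v p χ z.1 z.2 (ρ z.1 z.2) - flux v p χ z.1 z.2 k) * fderiv ℝ φ z (0, 1)
        - Real.sign (ρ z.1 z.2 - k) * deriv (fun y => flux v p χ z.1 y k) z.2 * φ z)
  initial : ∃ E : Set ℝ, volume E = 0 ∧
    Tendsto (fun t => eLpNorm (fun x => ρ t x - ρo x) 1 volume) (𝓝[Ioi 0 \ E] 0) (𝓝 0)

/-- The estimate `‖ρ'(t) - ρ(t)‖_{L¹} ≤ e^{Ct} ‖ρo' - ρo‖_{L¹}` for a.e. `t > 0`, for all pairs of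
Kružkov solutions. The norms take values in `[0,∞]`. -/
def L1LipschitzEstimate (v p χ : ℝ → ℝ) (C : ℝ) : Prop :=
  ∀ ρo ρo' : ℝ → ℝ, Datum ρo → Datum ρo' → ∀ ρ ρ' : ℝ → ℝ → ℝ,
    KruzkovSolution v p χ ρo ρ → KruzkovSolution v p χ ρo' ρ' →
    ∀ᵐ t ∂(volume.restrict (Ioi (0 : ℝ))),
      eLpNorm (fun x => ρ' t x - ρ t x) 1 volume
        ≤ ENNReal.ofReal (Real.exp (C * t)) * eLpNorm (fun x => ρo' x - ρo x) 1 volume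

/-- The map `g(r,q) = q r v(r) / (q + v(r))` (equal to `0` where `q = v(r) = 0`). -/
noncomputable def harmonicFlux (v : ℝ → ℝ) (r q : ℝ) : ℝ := q * r * v r / (q + v r)

/-- The numbers are Lipschitz constants of the maps that enter the constant `C`. The condition on
`Lh` holds in particular if `Lh` is a Lipschitz constant on `[0,1]` of `r ↦ r v(r) / (ṗ(t) + v(r))`
for every `t ≥ 0`, and the condition on `Lg` holds if `Lg` is a Lipschitz constant of `g` on
`[0,1] × [0,Lp]` for any `ℓ^s` norm, `1 ≤ s ≤ ∞`, on the plane. -/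
structure LipschitzConstants (v p χ : ℝ → ℝ) (Lχ Lp Lh Lq Lg La : ℝ≥0) : Prop where
  cutOff : LipschitzWith Lχ χ
  trajectory : LipschitzOnWith Lp p (Ici 0)
  harmonic : ∀ t, 0 ≤ t → ∀ r₁ ∈ Icc (0 : ℝ) 1, ∀ r₂ ∈ Icc (0 : ℝ) 1,
    |harmonicFlux v r₁ (velocity p t) - harmonicFlux v r₂ (velocity p t)| ≤ Lp * Lh * |r₁ - r₂|
  standard : LipschitzOnWith Lq (fun r => r * v r) (Icc 0 1)
  joint : ∀ r₁ ∈ Icc (0 : ℝ) 1, ∀ r₂ ∈ Icc (0 : ℝ) 1,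
    ∀ q₁ ∈ Icc (0 : ℝ) Lp, ∀ q₂ ∈ Icc (0 : ℝ) Lp,
      |harmonicFlux v r₁ q₁ - harmonicFlux v r₂ q₂| ≤ Lg * (|r₁ - r₂| + |q₁ - q₂|)
  acceleration : LipschitzOnWith La (velocity p) (Ici 0)

/-- `C = Lip(χ) (1 + Lip(p)) (Lip(p) L + Lip(ρv)) + Lip(g) Lip(ṗ)`. -/
def stabilityConstant (Lχ Lp Lh Lq Lg La : ℝ≥0) : ℝ≥0 :=
  Lχ * (1 + Lp) * (Lp * Lh + Lq) + Lg * La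

/-! The estimate holds with `C = 0`: the `L¹` distance of two Kružkov solutions never exceeds that
of their data (`KruzkovSolution.ae_eLpNorm_sub_le`). Since `e^{Ct} ≥ 1`, every non-negative `C` then
works, and equal data force equal solutions.

On a strip `0 < t < T` the flux is `a(t,x) G(t,r) + Q(r)` with `a = χ(x - p(t))`, `b = ∂ₓa`
continuous, and `G` Lipschitz in `t`, because the harmonic mean is Lipschitz in `ṗ` and `ṗ` is
Lipschitz in `t`. Variables are doubled with a kernel of width `h²` in time and `h` in space. The
zero-order terms left in the limit come from the quotient `(a(z) - a(z'))/h`, which tends to `ξ b`,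
and from the sources `∂ₓf(t,x,k)`, which yield `b`. Both multiply `G(t,max) - G(t,min)`, with
weights `ξ ∂_ξ` of the kernel and the kernel itself; the integrals of these weights are `-1` and
`1`. The time variation of `G` contributes only `O(h²)/h`. Hence `kato_inequality` has no zero-order
term, and no exponential growth appears.

Kato's inequality is tested with a cut-off of a backward cone whose slope bounds the speed of
propagation. The weighted distance is then weakly decreasing in time
(`integral_deriv_mul_coneWeight_nonneg`), so the initial condition bounds it at almost every time
(`ae_le_of_weakly_decreasing`). Letting the cone grow, Fatou's lemma gives the full `L¹` bound
(`ae_lintegral_sub_le`). -/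

/-! ### Small translations, in `L¹` and almost everywhere. -/

/-- Translation is continuous in `L¹`. -/
theorem tendsto_lintegral_translate {W : ℝ × ℝ → ℝ} (hW : Integrable W) :
    Tendsto (fun s : ℝ × ℝ => ∫⁻ z, ‖W (z - s) - W z‖ₑ) (𝓝 0) (𝓝 0) := by
  have hm : MemLp W 1 volume := memLp_one_iff_integrable.2 hW
  let g : ℝ × ℝ → C(ℝ × ℝ, ℝ × ℝ) := fun s => ⟨fun z => z - s, by fun_prop⟩
  have hg : Continuous g :=
    ContinuousMap.continuous_of_continuous_uncurry _
      (show Continuous fun q : (ℝ × ℝ) × (ℝ × ℝ) => q.2 - q.1 by fun_prop)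
  have hgm : ∀ s, MeasurePreserving (g s) volume volume := fun s =>
    measurePreserving_sub_right volume s
  have key := (tendsto_const_nhds (x := hm.toLp W)).compMeasurePreservingLp
    (hg.tendsto 0) hgm (hgm 0) ENNReal.one_ne_top
  rw [tendsto_iff_edist_tendsto_0] at key
  refine key.congr fun s => ?_
  rw [Lp.toLp_compMeasurePreserving, Lp.toLp_compMeasurePreserving, Lp.edist_toLp_toLp,
    eLpNorm_one_eq_lintegral_enorm]
  simp [g]

/-- Translations by vectors tending to zero converge almost everywhere along a subsequence. -/
theorem exists_seq_tendsto_ae_translate {w : ℝ × ℝ → ℝ} (hw : Measurable w)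
    (hb : ∀ z, |w z| ≤ 1) (S : ℕ → ℝ × ℝ → ℝ × ℝ) (hSc : ∀ n, Continuous (S n))
    (hS : ∀ e, Tendsto (fun n => S n e) atTop (𝓝 0)) (R : ℝ) (ν : Measure (ℝ × ℝ))
    [IsFiniteMeasure ν] :
    ∃ ns : ℕ → ℕ, StrictMono ns ∧ ∀ᵐ q ∂((volume : Measure (ℝ × ℝ)).prod ν),
      q.1 ∈ Metric.ball 0 R →
        Tendsto (fun n => w (q.1 - S (ns n) q.2)) atTop (𝓝 (w q.1)) := by
  -- Truncation makes `w` integrable. The ball is open and `S n e → 0`, so at points of the ball the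
  -- truncation is invisible for large `n`.
  set W : ℝ × ℝ → ℝ := (Metric.ball 0 R).indicator w with hWdef
  have hWm : Measurable W := hw.indicator Metric.isOpen_ball.measurableSet
  have hW : Integrable W := by
    rw [integrable_indicator_iff Metric.isOpen_ball.measurableSet]
    exact Measure.integrableOn_of_bounded (M := 1) measure_ball_lt_top.ne
      hw.aestronglyMeasurable (Eventually.of_forall hb)
  have hpre : ∀ n, Measurable fun q : (ℝ × ℝ) × (ℝ × ℝ) => W (q.1 - S n q.2) := fun n =>
    hWm.comp (measurable_fst.sub ((hSc n).measurable.comp measurable_snd))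
  have hmeas : ∀ n, Measurable fun q : (ℝ × ℝ) × (ℝ × ℝ) =>
      ‖W (q.1 - S n q.2) - W q.1‖ₑ := fun n =>
    ((hpre n).sub (hWm.comp measurable_fst)).enorm
  have hlim : Tendsto (fun n => ∫⁻ e, (∫⁻ z, ‖W (z - S n e) - W z‖ₑ) ∂ν) atTop (𝓝 0) := by
    have h0 : (0 : ℝ≥0∞) = ∫⁻ _, 0 ∂ν := by simp
    rw [h0]
    refine tendsto_lintegral_of_dominated_convergence
      (fun _ => (∫⁻ z, ‖W z‖ₑ) + ∫⁻ z, ‖W z‖ₑ) (fun n => (hmeas n).lintegral_prod_left') ?_ ?_ ?_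
    · intro n
      refine Eventually.of_forall fun e => ?_
      calc ∫⁻ z, ‖W (z - S n e) - W z‖ₑ ≤ ∫⁻ z, (‖W (z - S n e)‖ₑ + ‖W z‖ₑ) :=
            lintegral_mono fun z => enorm_sub_le
        _ = (∫⁻ z, ‖W (z - S n e)‖ₑ) + ∫⁻ z, ‖W z‖ₑ := lintegral_add_right _ hWm.enorm
        _ = _ := by rw [lintegral_sub_right_eq_self (fun z => ‖W z‖ₑ)]
    · rw [lintegral_const]
      exact ENNReal.mul_ne_top (ENNReal.add_ne_top.2 ⟨hW.2.ne, hW.2.ne⟩) (measure_ne_top _ _)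
    · exact Eventually.of_forall fun e => (tendsto_lintegral_translate hW).comp (hS e)
  -- Averaging over `e` gives `L¹` convergence on the product space, hence convergence in measure
  -- and, along one subsequence, for almost every pair.
  have hin : TendstoInMeasure ((volume : Measure (ℝ × ℝ)).prod ν)
      (fun n q => W (q.1 - S n q.2)) atTop (fun q => W q.1) := by
    refine tendstoInMeasure_of_tendsto_eLpNorm one_ne_zero
      (fun n => (hpre n).aestronglyMeasurable)
      (hWm.comp measurable_fst).aestronglyMeasurable ?_
    refine hlim.congr fun n => ?_
    rw [eLpNorm_one_eq_lintegral_enorm]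
    exact (lintegral_prod_symm' _ (hmeas n)).symm
  obtain ⟨ns, hns, hae⟩ := hin.exists_seq_tendsto_ae
  refine ⟨ns, hns, ?_⟩
  filter_upwards [hae] with q hq hqR
  have h1 : W q.1 = w q.1 := indicator_of_mem hqR w
  rw [h1] at hq
  have h2 : Tendsto (fun n => q.1 - S (ns n) q.2) atTop (𝓝 q.1) := by
    simpa using tendsto_const_nhds.sub ((hS q.2).comp hns.tendsto_atTop)
  refine hq.congr' ?_
  filter_upwards [h2.eventually (Metric.isOpen_ball.mem_nhds hqR)] with n hn
  exact indicator_of_mem (s := Metric.ball (0 : ℝ × ℝ) R) hn w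

/-! ### Bounded measurable functions -/

/-- Bounded measurable real functions. -/
def BddMeasurable {α : Type*} [MeasurableSpace α] (f : α → ℝ) : Prop :=
  Measurable f ∧ ∃ C, ∀ x, |f x| ≤ C

namespace BddMeasurable

variable {α β : Type*} [MeasurableSpace α] [MeasurableSpace β] {f g : α → ℝ}

theorem const (c : ℝ) : BddMeasurable fun _ : α => c := ⟨measurable_const, |c|, fun _ => le_rfl⟩

theorem neg (hf : BddMeasurable f) : BddMeasurable fun x => - f x := by
  obtain ⟨hfm, C, hC⟩ := hf
  exact ⟨hfm.neg, C, fun x => by simpa using hC x⟩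

theorem abs (hf : BddMeasurable f) : BddMeasurable fun x => |f x| := by
  obtain ⟨hfm, C, hC⟩ := hf
  exact ⟨measurable_norm.comp hfm, C, fun x => by simpa using hC x⟩

theorem add (hf : BddMeasurable f) (hg : BddMeasurable g) :
    BddMeasurable fun x => f x + g x := by
  obtain ⟨hfm, C, hC⟩ := hf
  obtain ⟨hgm, D, hD⟩ := hg
  exact ⟨hfm.add hgm, C + D, fun x => (abs_add_le _ _).trans (add_le_add (hC x) (hD x))⟩

theorem sub (hf : BddMeasurable f) (hg : BddMeasurable g) :
    BddMeasurable fun x => f x - g x := by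
  simpa only [sub_eq_add_neg] using hf.add hg.neg

theorem mul (hf : BddMeasurable f) (hg : BddMeasurable g) :
    BddMeasurable fun x => f x * g x := by
  obtain ⟨hfm, C, hC⟩ := hf
  obtain ⟨hgm, D, hD⟩ := hg
  refine ⟨hfm.mul hgm, C * D, fun x => ?_⟩
  rw [abs_mul]
  exact mul_le_mul (hC x) (hD x) (abs_nonneg _) ((abs_nonneg _).trans (hC x))

theorem div_const (hf : BddMeasurable f) (c : ℝ) : BddMeasurable fun x => f x / c := by
  simpa only [div_eq_mul_inv] using hf.mul (const c⁻¹)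

theorem comp (hf : BddMeasurable f) {k : β → α} (hk : Measurable k) :
    BddMeasurable fun x => f (k x) := by
  obtain ⟨hfm, C, hC⟩ := hf
  exact ⟨hfm.comp hk, C, fun x => hC _⟩

theorem sign (hf : Measurable f) : BddMeasurable fun x => Real.sign (f x) := by
  have hs : Measurable Real.sign := by
    unfold Real.sign
    exact Measurable.ite measurableSet_Iio measurable_const
      (Measurable.ite measurableSet_Ioi measurable_const measurable_const)
  refine ⟨hs.comp hf, 1, fun x => ?_⟩
  rcases Real.sign_apply_eq (f x) with h | h | h <;> simp [h]

theorem integrable (hf : BddMeasurable f) {μ : Measure α} {s : Set α} (hs : μ s ≠ ⊤)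
    (h0 : ∀ x, x ∉ s → f x = 0) : Integrable f μ := by
  obtain ⟨hfm, C, hC⟩ := hf
  rw [← integrableOn_iff_integrable_of_support_subset (s := s)
    (fun x hx => by_contra fun h => hx (h0 x h))]
  exact Measure.integrableOn_of_bounded hs hfm.aestronglyMeasurable (Eventually.of_forall hC)

end BddMeasurable

theorem Continuous.bddMeasurable_of_hasCompactSupport {E : Type*} [NormedAddCommGroup E]
    [MeasurableSpace E] [BorelSpace E] {f : E → ℝ} (hf : Continuous f)
    (hc : HasCompactSupport f) : BddMeasurable f := by
  obtain ⟨C, hC⟩ := hc.exists_bound_of_continuous hf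
  exact ⟨hf.measurable, C, hC⟩

/-! ### The entropy flux in terms of the maximum and the minimum -/

/-- For continuous `f` the right side is continuous in `(x, y)`, although the sign is not. This
allows limits at points where the two solutions coincide. -/
theorem sign_mul_sub_eq (f : ℝ → ℝ) (x y : ℝ) :
    Real.sign (x - y) * (f x - f y) = f (max x y) - f (min x y) := by
  rcases lt_trichotomy x y with h | h | h
  · rw [Real.sign_of_neg (sub_neg.2 h), max_eq_right h.le, min_eq_left h.le]; ring
  · simp [h]
  · rw [Real.sign_of_pos (sub_pos.2 h), max_eq_left h.le, min_eq_right h.le]; ring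

theorem abs_sign_le_one (x : ℝ) : |Real.sign x| ≤ 1 := by
  rcases Real.sign_apply_eq x with h | h | h <;> simp [h]

/-! ### Separable fluxes and their entropy solutions -/

/-- Flux of the form `a(t,x) G(t,r) + Q(r)`. -/
def splitFlux (a : ℝ × ℝ → ℝ) (G : ℝ → ℝ → ℝ) (Q : ℝ → ℝ) (z : ℝ × ℝ) (r : ℝ) : ℝ :=
  a z * G z.1 r + Q r

/-- Regularity of the flux `a(t,x) G(t,r) + Q(r)`, with `∂ₓ a = b` for `0 < t < T`. -/
structure SplitFluxRegular (T L : ℝ) (a b : ℝ × ℝ → ℝ) (G : ℝ → ℝ → ℝ) (Q : ℝ → ℝ) : Prop where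
  a_bdd : ∀ z, |a z| ≤ L
  a_lip : ∀ z z', |a z - a z'| ≤ L * (|z.1 - z'.1| + |z.2 - z'.2|)
  b_bdd : ∀ z, |b z| ≤ L
  b_cont : Continuous b
  -- Only interior times: freezing time outside `[0,T]` may destroy differentiability at the two
  -- ends.
  a_diff : ∀ z : ℝ × ℝ, z.1 ∈ Ioo 0 T → ∃ A : ℝ × ℝ →L[ℝ] ℝ, HasFDerivAt a A z ∧ A (0, 1) = b z
  G_cont : Continuous (Function.uncurry G)
  G_bdd : ∀ t r, |G t r| ≤ L
  G_time : ∀ t s r, |G t r - G s r| ≤ L * |t - s|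
  Q_cont : Continuous Q
  Q_bdd : ∀ r, |Q r| ≤ L
  -- Here `L` is also the speed of propagation, used as the slope of the cones.
  flux_lip : ∀ z r r', |splitFlux a G Q z r - splitFlux a G Q z r'| ≤ L * |r - r'|

/-- Entropy inequalities on the strip `(0,T) × ℝ` for the flux `a(t,x) G(t,r) + Q(r)`. -/
def IsEntropySolution (T : ℝ) (a b : ℝ × ℝ → ℝ) (G : ℝ → ℝ → ℝ) (Q : ℝ → ℝ)
    (u : ℝ × ℝ → ℝ) : Prop :=
  ∀ k ∈ Icc (0 : ℝ) 1, ∀ φ : ℝ × ℝ → ℝ, ContDiff ℝ ∞ φ → HasCompactSupport φ →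
    tsupport φ ⊆ Ioo 0 T ×ˢ univ → (∀ z, 0 ≤ φ z) →
    0 ≤ ∫ z, (|u z - k| * fderiv ℝ φ z (1, 0)
      + Real.sign (u z - k) * (splitFlux a G Q z (u z) - splitFlux a G Q z k)
        * fderiv ℝ φ z (0, 1)
      - Real.sign (u z - k) * (b z * G z.1 k) * φ z)

namespace SplitFluxRegular

variable {T L : ℝ} {a b : ℝ × ℝ → ℝ} {G : ℝ → ℝ → ℝ} {Q : ℝ → ℝ}

theorem nonneg (H : SplitFluxRegular T L a b G Q) : 0 ≤ L := (abs_nonneg _).trans (H.a_bdd 0)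

theorem a_cont (H : SplitFluxRegular T L a b G Q) : Continuous a := by
  refine continuous_iff_continuousAt.2 fun z => ?_
  rw [ContinuousAt, tendsto_iff_norm_sub_tendsto_zero]
  refine squeeze_zero (fun _ => norm_nonneg _) (fun z' => H.a_lip z' z) ?_
  have : Continuous fun z' : ℝ × ℝ => L * (|z'.1 - z.1| + |z'.2 - z.2|) := by fun_prop
  simpa using this.tendsto z

theorem flux_bdd (H : SplitFluxRegular T L a b G Q) (z : ℝ × ℝ) (r : ℝ) :
    |splitFlux a G Q z r| ≤ L * L + L := by
  refine (abs_add_le _ _).trans (add_le_add ?_ (H.Q_bdd r))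
  rw [abs_mul]
  exact mul_le_mul (H.a_bdd _) (H.G_bdd _ _) (abs_nonneg _) H.nonneg

theorem flux_cont (H : SplitFluxRegular T L a b G Q) :
    Continuous fun q : (ℝ × ℝ) × ℝ => splitFlux a G Q q.1 q.2 := by
  have h3 : Continuous fun q : (ℝ × ℝ) × ℝ => G q.1.1 q.2 :=
    H.G_cont.comp (by fun_prop : Continuous fun q : (ℝ × ℝ) × ℝ => (q.1.1, q.2))
  exact ((H.a_cont.comp continuous_fst).mul h3).add (H.Q_cont.comp continuous_snd)

end SplitFluxRegular

/-! ### Mollifier and anisotropic scaling -/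

/-- A smooth non-negative mollifier on the line supported in `[-1,1]`. -/
structure Mollifier (θ : ℝ → ℝ) : Prop where
  contDiff : ContDiff ℝ ∞ θ
  nonneg : ∀ x, 0 ≤ θ x
  tsupport_subset : tsupport θ ⊆ Icc (-1) 1
  integral_eq_one : ∫ x, θ x = 1

theorem exists_mollifier : ∃ θ, Mollifier θ := by
  let f : ContDiffBump (0 : ℝ) := ⟨1 / 2, 1, by norm_num, by norm_num⟩
  refine ⟨f.normed volume, f.contDiff_normed, f.nonneg_normed, ?_, f.integral_normed⟩
  rw [f.tsupport_normed_eq, Real.closedBall_eq_Icc]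
  simp [f]

namespace Mollifier

variable {θ : ℝ → ℝ}

theorem hasCompactSupport (hθ : Mollifier θ) : HasCompactSupport θ :=
  isCompact_Icc.of_isClosed_subset (isClosed_tsupport _) hθ.tsupport_subset

theorem eq_zero (hθ : Mollifier θ) {x : ℝ} (hx : 1 < |x|) : θ x = 0 :=
  image_eq_zero_of_notMem_tsupport fun h => by
    have := hθ.tsupport_subset h
    exact absurd (abs_le.2 this) (not_le.2 hx)

theorem deriv_eq_zero (hθ : Mollifier θ) {x : ℝ} (hx : 1 < |x|) : deriv θ x = 0 :=
  image_eq_zero_of_notMem_tsupport fun h => by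
    have := hθ.tsupport_subset (tsupport_deriv_subset h)
    exact absurd (abs_le.2 this) (not_le.2 hx)

theorem continuous_deriv (hθ : Mollifier θ) : Continuous (deriv θ) :=
  hθ.contDiff.continuous_deriv (by simp)

theorem differentiable (hθ : Mollifier θ) : Differentiable ℝ θ :=
  hθ.contDiff.differentiable (by simp)

theorem integrable (hθ : Mollifier θ) : Integrable θ :=
  hθ.contDiff.continuous.integrable_of_hasCompactSupport hθ.hasCompactSupport

theorem integrable_id_mul_deriv (hθ : Mollifier θ) : Integrable fun x => x * deriv θ x :=
  (continuous_id.mul hθ.continuous_deriv).integrable_of_hasCompactSupport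
    hθ.hasCompactSupport.deriv.mul_left

/-- Integration by parts. This `-1` later cancels the unit mass of the kernel. -/
theorem integral_id_mul_deriv (hθ : Mollifier θ) : ∫ x, x * deriv θ x = -1 := by
  have := integral_mul_deriv_eq_deriv_mul_of_integrable (u := fun x : ℝ => x) (u' := fun _ => 1)
    (v := θ) (v' := deriv θ) (fun x _ => hasDerivAt_id x)
    (fun x _ => (hθ.differentiable x).hasDerivAt) hθ.integrable_id_mul_deriv
    (hθ.integrable.const_mul 1)
    ((continuous_id.mul hθ.contDiff.continuous).integrable_of_hasCompactSupport
      hθ.hasCompactSupport.mul_left)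
  rw [this]
  simp [hθ.integral_eq_one]

end Mollifier

/-- The anisotropic scaling `(τ,ξ) ↦ (h² τ, h ξ)`. -/
def scaling (h : ℝ) (e : ℝ × ℝ) : ℝ × ℝ := (h ^ 2 * e.1, h * e.2)

/-- The inverse of the anisotropic scaling. -/
noncomputable def unscaling (h : ℝ) (e : ℝ × ℝ) : ℝ × ℝ := (e.1 / h ^ 2, e.2 / h)

theorem continuous_scaling (h : ℝ) : Continuous (scaling h) := by unfold scaling; fun_prop

theorem continuous_unscaling (h : ℝ) : Continuous (unscaling h) := by unfold unscaling; fun_prop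

theorem unscaling_scaling {h : ℝ} (hh : h ≠ 0) (e : ℝ × ℝ) : unscaling h (scaling h e) = e := by
  ext <;> simp [unscaling, scaling] <;> field_simp

theorem scaling_unscaling {h : ℝ} (hh : h ≠ 0) (e : ℝ × ℝ) : scaling h (unscaling h e) = e := by
  ext <;> simp [unscaling, scaling] <;> field_simp

/-- Change of variables `z' = z - (h² τ, h ξ)`. -/
theorem exists_integral_sub_scaling {h : ℝ} (hh : h ≠ 0) :
    ∃ c : ℝ, 0 < c ∧ ∀ (z : ℝ × ℝ) (f : ℝ × ℝ → ℝ),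
      ∫ e, f (z - scaling h e) = c * ∫ z', f z' := by
  let S : (ℝ × ℝ) ≃ₗ[ℝ] (ℝ × ℝ) :=
    { toFun := scaling h
      invFun := unscaling h
      left_inv := unscaling_scaling hh
      right_inv := scaling_unscaling hh
      map_add' := fun x y => by ext <;> simp [scaling] <;> ring
      map_smul' := fun m x => by ext <;> simp [scaling] <;> ring }
  have hdet : LinearMap.det (S : (ℝ × ℝ) →ₗ[ℝ] (ℝ × ℝ)) ≠ 0 := S.isUnit_det'.ne_zero
  -- The constant is the inverse Jacobian. It is the same for all `z` and `f`, and only its sign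
  -- matters when a non-negative integral is rescaled.
  refine ⟨|(LinearMap.det (S : (ℝ × ℝ) →ₗ[ℝ] (ℝ × ℝ)))⁻¹|, abs_pos.2 (inv_ne_zero hdet), ?_⟩
  intro z f
  have hmap := Measure.map_linearMap_addHaar_eq_smul_addHaar (volume : Measure (ℝ × ℝ)) hdet
  have hemb : MeasurableEmbedding (S : (ℝ × ℝ) →ₗ[ℝ] (ℝ × ℝ)) :=
    S.toContinuousLinearEquiv.toHomeomorph.measurableEmbedding
  have h1 := hemb.integral_map (μ := volume) (fun e => f (z - e))
  rw [hmap, integral_smul_measure, ENNReal.toReal_ofReal (abs_nonneg _), smul_eq_mul,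
    integral_sub_left_eq_self] at h1
  exact h1.symm

/-! ### Doubling of variables -/

section Doubling

variable (θ : ℝ → ℝ) (h : ℝ) (a b : ℝ × ℝ → ℝ) (G : ℝ → ℝ → ℝ) (Q : ℝ → ℝ)
  (u w ψ : ℝ × ℝ → ℝ)

/-- The kernel `θ(τ) θ(ξ)`. -/
def kernel (e : ℝ × ℝ) : ℝ := θ e.1 * θ e.2

/-- The derivative of the kernel in the first variable. -/
noncomputable def kernelTime (e : ℝ × ℝ) : ℝ := deriv θ e.1 * θ e.2

/-- The derivative of the kernel in the second variable. -/
noncomputable def kernelSpace (e : ℝ × ℝ) : ℝ := θ e.1 * deriv θ e.2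

/-- Integrand of the entropy inequality of `u` at `z` for the constant `w z'` and the test
function `ψ(z) θ((t-s)/h²) θ((x-y)/h)`, with `e` standing for the scaled difference `z - z'`. -/
noncomputable def doublingLeft (z z' e : ℝ × ℝ) : ℝ :=
  |u z - w z'| * (fderiv ℝ ψ z (1, 0) * kernel θ e + ψ z * (kernelTime θ e / h ^ 2))
    + Real.sign (u z - w z') * (splitFlux a G Q z (u z) - splitFlux a G Q z (w z'))
      * (fderiv ℝ ψ z (0, 1) * kernel θ e + ψ z * (kernelSpace θ e / h))
    - Real.sign (u z - w z') * (b z * G z.1 (w z')) * (ψ z * kernel θ e)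

/-- Integrand of the entropy inequality of `w` at `z'` for the constant `u z` and the same test
function. -/
noncomputable def doublingRight (z z' e : ℝ × ℝ) : ℝ :=
  |w z' - u z| * (-(ψ z * (kernelTime θ e / h ^ 2)))
    + Real.sign (w z' - u z) * (splitFlux a G Q z' (w z') - splitFlux a G Q z' (u z))
      * (-(ψ z * (kernelSpace θ e / h)))
    - Real.sign (w z' - u z) * (b z' * G z'.1 (u z)) * (ψ z * kernel θ e)

variable {θ h a b G Q u w ψ}

theorem kernel_eq_zero (hθ : Mollifier θ) {e : ℝ × ℝ} (he : e ∉ Metric.closedBall (0 : ℝ × ℝ) 1) :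
    kernel θ e = 0 ∧ kernelTime θ e = 0 ∧ kernelSpace θ e = 0 := by
  have : 1 < |e.1| ∨ 1 < |e.2| := by
    by_contra! hc
    exact he (by simpa [Prod.norm_def] using hc)
  rcases this with h1 | h1 <;>
    simp [kernel, kernelTime, kernelSpace, hθ.eq_zero h1, hθ.deriv_eq_zero h1]

theorem contDiff_kernel (hθ : Mollifier θ) : ContDiff ℝ ∞ (kernel θ) :=
  (hθ.contDiff.comp contDiff_fst).mul (hθ.contDiff.comp contDiff_snd)

theorem continuous_kernelTime (hθ : Mollifier θ) : Continuous (kernelTime θ) :=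
  (hθ.continuous_deriv.comp continuous_fst).mul (hθ.contDiff.continuous.comp continuous_snd)

theorem continuous_kernelSpace (hθ : Mollifier θ) : Continuous (kernelSpace θ) :=
  (hθ.contDiff.continuous.comp continuous_fst).mul (hθ.continuous_deriv.comp continuous_snd)

theorem hasCompactSupport_kernel (hθ : Mollifier θ) : HasCompactSupport (kernel θ) :=
  HasCompactSupport.intro (isCompact_closedBall 0 1) fun _ he => (kernel_eq_zero hθ he).1

theorem hasCompactSupport_kernelTime (hθ : Mollifier θ) : HasCompactSupport (kernelTime θ) :=
  HasCompactSupport.intro (isCompact_closedBall 0 1) fun _ he => (kernel_eq_zero hθ he).2.1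

theorem hasCompactSupport_kernelSpace (hθ : Mollifier θ) : HasCompactSupport (kernelSpace θ) :=
  HasCompactSupport.intro (isCompact_closedBall 0 1) fun _ he => (kernel_eq_zero hθ he).2.2

theorem hasFDerivAt_kernel (hθ : Mollifier θ) (e : ℝ × ℝ) :
    HasFDerivAt (kernel θ) (kernelTime θ e • ContinuousLinearMap.fst ℝ ℝ ℝ
      + kernelSpace θ e • ContinuousLinearMap.snd ℝ ℝ ℝ) e := by
  have h1 : HasFDerivAt (fun e : ℝ × ℝ => θ e.1) (deriv θ e.1 • ContinuousLinearMap.fst ℝ ℝ ℝ) e :=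
    (hθ.differentiable e.1).hasDerivAt.comp_hasFDerivAt e hasFDerivAt_fst
  have h2 : HasFDerivAt (fun e : ℝ × ℝ => θ e.2) (deriv θ e.2 • ContinuousLinearMap.snd ℝ ℝ ℝ) e :=
    (hθ.differentiable e.2).hasDerivAt.comp_hasFDerivAt e hasFDerivAt_snd
  refine (h1.mul h2).congr_fderiv ?_
  ext <;> simp [kernelTime, kernelSpace] <;> ring

/-- `unscaling` as a continuous linear map. -/
noncomputable def unscalingL (h : ℝ) : ℝ × ℝ →L[ℝ] ℝ × ℝ :=
  ((h ^ 2)⁻¹ • ContinuousLinearMap.fst ℝ ℝ ℝ).prod (h⁻¹ • ContinuousLinearMap.snd ℝ ℝ ℝ)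

theorem unscalingL_apply (h : ℝ) (e : ℝ × ℝ) : unscalingL h e = unscaling h e := by
  ext <;> simp [unscalingL, unscaling] <;> ring

theorem contDiff_unscaling (h : ℝ) : ContDiff ℝ ∞ (unscaling h) := by
  have : unscaling h = unscalingL h := funext fun e => (unscalingL_apply h e).symm
  rw [this]
  exact (unscalingL h).contDiff

theorem hasFDerivAt_unscaling (h : ℝ) (e : ℝ × ℝ) :
    HasFDerivAt (unscaling h) (unscalingL h) e := by
  have : unscaling h = unscalingL h := funext fun e => (unscalingL_apply h e).symm
  rw [this]
  exact (unscalingL h).hasFDerivAt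

theorem fderiv_test_left (hθ : Mollifier θ) (hψ : ContDiff ℝ ∞ ψ) (z z' d : ℝ × ℝ) :
    fderiv ℝ (fun z => ψ z * kernel θ (unscaling h (z - z'))) z d =
      fderiv ℝ ψ z d * kernel θ (unscaling h (z - z')) +
        ψ z * (kernelTime θ (unscaling h (z - z')) * (d.1 / h ^ 2)
          + kernelSpace θ (unscaling h (z - z')) * (d.2 / h)) := by
  have h1 : HasFDerivAt (fun z => unscaling h (z - z'))
      ((unscalingL h).comp (ContinuousLinearMap.id ℝ (ℝ × ℝ))) z :=
    HasFDerivAt.comp (g := unscaling h) z (hasFDerivAt_unscaling h (z - z'))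
      ((hasFDerivAt_id z).sub_const z')
  have h2 : HasFDerivAt (fun z => kernel θ (unscaling h (z - z'))) _ z :=
    (hasFDerivAt_kernel hθ _).comp z h1
  have h3 := ((hψ.differentiable (by simp) z).hasFDerivAt).mul h2
  have h4 : HasFDerivAt (fun z => ψ z * kernel θ (unscaling h (z - z'))) _ z := h3
  rw [h4.fderiv]
  simp [unscalingL]
  ring

/-- The cut-off `ψ` is evaluated at `z` rather than at a midpoint, so as a function of `z'` it is
the constant `c` and only the kernel is differentiated. -/
theorem fderiv_test_right (hθ : Mollifier θ) (c : ℝ) (z z' d : ℝ × ℝ) :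
    fderiv ℝ (fun z' => c * kernel θ (unscaling h (z - z'))) z' d =
      -(c * (kernelTime θ (unscaling h (z - z')) * (d.1 / h ^ 2)
          + kernelSpace θ (unscaling h (z - z')) * (d.2 / h))) := by
  have h1 : HasFDerivAt (fun z' => unscaling h (z - z'))
      ((unscalingL h).comp (-ContinuousLinearMap.id ℝ (ℝ × ℝ))) z' :=
    (hasFDerivAt_unscaling h (z - z')).comp z' ((hasFDerivAt_id z').const_sub z)
  have h2 : HasFDerivAt (fun z' => kernel θ (unscaling h (z - z'))) _ z' :=
    (hasFDerivAt_kernel hθ _).comp z' h1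
  have h4 : HasFDerivAt (fun z' => c * kernel θ (unscaling h (z - z'))) _ z' := h2.const_mul c
  rw [h4.fderiv]
  simp [unscalingL]
  ring

theorem integral_doublingLeft_nonneg {T : ℝ} (hθ : Mollifier θ) (hu : IsEntropySolution T a b G Q u)
    (hw01 : ∀ z, w z ∈ Icc (0 : ℝ) 1) (hψ : ContDiff ℝ ∞ ψ) (hψc : HasCompactSupport ψ)
    (hψs : tsupport ψ ⊆ Ioo 0 T ×ˢ univ) (hψ0 : ∀ z, 0 ≤ ψ z) (z' : ℝ × ℝ) :
    0 ≤ ∫ z, doublingLeft θ h a b G Q u w ψ z z' (unscaling h (z - z')) := by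
  have key := hu (w z') (hw01 z') (fun z => ψ z * kernel θ (unscaling h (z - z')))
    (hψ.mul ((contDiff_kernel hθ).comp ((contDiff_unscaling h).comp
      (contDiff_id.sub contDiff_const)))) hψc.mul_right
    ((tsupport_mul_subset_left).trans hψs)
    (fun z => mul_nonneg (hψ0 z) (mul_nonneg (hθ.nonneg _) (hθ.nonneg _)))
  refine key.trans_eq (integral_congr_ae (Eventually.of_forall fun z => ?_))
  simp only [fderiv_test_left hθ hψ, doublingLeft]
  ring

/-- In `z'` the test function lives on a box of half-width `h²` in time around `z`, which can leave
the strip even when `z` lies in the support of `ψ`; `hsmall` prevents this. -/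
theorem integral_doublingRight_nonneg {T : ℝ} (hθ : Mollifier θ) (hh : 0 < h)
    (hw : IsEntropySolution T a b G Q w) (hu01 : ∀ z, u z ∈ Icc (0 : ℝ) 1)
    (hψ0 : ∀ z, 0 ≤ ψ z)
    (hsmall : ∀ z ∈ tsupport ψ, ∀ s, |s - z.1| ≤ h ^ 2 → s ∈ Ioo 0 T) (z : ℝ × ℝ) :
    0 ≤ ∫ z', doublingRight θ h a b G Q u w ψ z z' (unscaling h (z - z')) := by
  by_cases hz : z ∈ tsupport ψ
  swap
  · simp [doublingRight, image_eq_zero_of_notMem_tsupport hz]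
  have hsub : (Function.support fun z' => ψ z * kernel θ (unscaling h (z - z'))) ⊆
      Icc (z.1 - h ^ 2) (z.1 + h ^ 2) ×ˢ Icc (z.2 - h) (z.2 + h) := by
    intro z' hz'
    have h1 : unscaling h (z - z') ∈ Metric.closedBall (0 : ℝ × ℝ) 1 := by
      by_contra hc
      exact hz' (by simp [(kernel_eq_zero hθ hc).1])
    simp only [unscaling, mem_closedBall_zero_iff, Prod.norm_def, sup_le_iff, Real.norm_eq_abs,
      abs_div, abs_of_pos hh, abs_of_pos (pow_pos hh 2), div_le_one hh,
      div_le_one (pow_pos hh 2), Prod.fst_sub, Prod.snd_sub, abs_le] at h1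
    refine ⟨⟨?_, ?_⟩, ⟨?_, ?_⟩⟩ <;> linarith [h1.1.1, h1.1.2, h1.2.1, h1.2.2]
  have hts := closure_minimal hsub (isClosed_Icc.prod isClosed_Icc)
  have key := hw (u z) (hu01 z) (fun z' => ψ z * kernel θ (unscaling h (z - z')))
    (contDiff_const.mul ((contDiff_kernel hθ).comp ((contDiff_unscaling h).comp
      (contDiff_const.sub contDiff_id))))
    ((isCompact_Icc.prod isCompact_Icc).of_isClosed_subset (isClosed_tsupport _) hts)
    (fun z' hz' => by
      have := hts hz'
      refine ⟨hsmall z hz _ ?_, mem_univ _⟩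
      rw [abs_le]
      constructor <;> linarith [this.1.1, this.1.2])
    (fun z' => mul_nonneg (hψ0 z) (mul_nonneg (hθ.nonneg _) (hθ.nonneg _)))
  refine key.trans_eq (integral_congr_ae (Eventually.of_forall fun z' => ?_))
  simp only [fderiv_test_right hθ, doublingRight]
  ring

end Doubling

/-! ### Integrability of the doubled integrands, scaled variables and regrouping. -/

section DoublingLimit

variable {T L h : ℝ} {θ : ℝ → ℝ} {a b : ℝ × ℝ → ℝ} {G : ℝ → ℝ → ℝ} {Q : ℝ → ℝ}
  {u w ψ : ℝ × ℝ → ℝ}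

theorem bddMeasurable_of_mem_Icc {α : Type*} [MeasurableSpace α] {f : α → ℝ} (hf : Measurable f)
    (h01 : ∀ x, f x ∈ Icc (0 : ℝ) 1) : BddMeasurable f :=
  ⟨hf, 1, fun x => abs_le.2 ⟨by linarith [(h01 x).1], (h01 x).2⟩⟩

theorem continuous_fderiv_apply_const (hψ : ContDiff ℝ ∞ ψ) (d : ℝ × ℝ) :
    Continuous fun z => fderiv ℝ ψ z d :=
  (hψ.continuous_fderiv (by simp)).clm_apply continuous_const

theorem fderiv_apply_eq_zero_of_notMem_tsupport {z : ℝ × ℝ} (hz : z ∉ tsupport ψ) (d : ℝ × ℝ) :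
    fderiv ℝ ψ z d = 0 := by
  have : fderiv ℝ ψ z = 0 :=
    image_eq_zero_of_notMem_tsupport fun hc => hz (tsupport_fderiv_subset ℝ hc)
  simp [this]

theorem bddMeasurable_fderiv_apply (hψ : ContDiff ℝ ∞ ψ) (hψc : HasCompactSupport ψ)
    (d : ℝ × ℝ) : BddMeasurable fun z => fderiv ℝ ψ z d :=
  (continuous_fderiv_apply_const hψ d).bddMeasurable_of_hasCompactSupport
    (hψc.fderiv_apply ℝ d)

theorem SplitFluxRegular.bddMeasurable_flux (H : SplitFluxRegular T L a b G Q) {α : Type*}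
    [MeasurableSpace α] {Z : α → ℝ × ℝ} {r : α → ℝ} (hZ : Measurable Z) (hr : Measurable r) :
    BddMeasurable fun q => splitFlux a G Q (Z q) (r q) :=
  ⟨H.flux_cont.measurable.comp (hZ.prodMk hr), _, fun _ => H.flux_bdd _ _⟩

theorem SplitFluxRegular.bddMeasurable_deriv_flux (H : SplitFluxRegular T L a b G Q) {α : Type*}
    [MeasurableSpace α] {Z : α → ℝ × ℝ} {r : α → ℝ} (hZ : Measurable Z) (hr : Measurable r) :
    BddMeasurable fun q => b (Z q) * G (Z q).1 (r q) :=
  BddMeasurable.mul ⟨H.b_cont.measurable.comp hZ, _, fun _ => H.b_bdd _⟩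
    ⟨H.G_cont.measurable.comp ((measurable_fst.comp hZ).prodMk hr), _, fun _ => H.G_bdd _ _⟩

theorem bddMeasurable_kernel (hθ : Mollifier θ) : BddMeasurable (kernel θ) :=
  (contDiff_kernel hθ).continuous.bddMeasurable_of_hasCompactSupport (hasCompactSupport_kernel hθ)

theorem bddMeasurable_kernelTime (hθ : Mollifier θ) : BddMeasurable (kernelTime θ) :=
  (continuous_kernelTime hθ).bddMeasurable_of_hasCompactSupport (hasCompactSupport_kernelTime hθ)

theorem bddMeasurable_kernelSpace (hθ : Mollifier θ) : BddMeasurable (kernelSpace θ) :=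
  (continuous_kernelSpace hθ).bddMeasurable_of_hasCompactSupport (hasCompactSupport_kernelSpace hθ)

theorem bddMeasurable_doublingLeft (H : SplitFluxRegular T L a b G Q) (hθ : Mollifier θ)
    (hu : Measurable u) (hu01 : ∀ z, u z ∈ Icc (0 : ℝ) 1)
    (hw : Measurable w) (hw01 : ∀ z, w z ∈ Icc (0 : ℝ) 1)
    (hψ : ContDiff ℝ ∞ ψ) (hψc : HasCompactSupport ψ) {α : Type*}
    [MeasurableSpace α] {Z Z' E : α → ℝ × ℝ} (hZ : Measurable Z) (hZ' : Measurable Z')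
    (hE : Measurable E) :
    BddMeasurable fun q => doublingLeft θ h a b G Q u w ψ (Z q) (Z' q) (E q) := by
  have hub := (bddMeasurable_of_mem_Icc hu hu01).comp hZ
  have hwb := (bddMeasurable_of_mem_Icc hw hw01).comp hZ'
  have hs := BddMeasurable.sign (hub.sub hwb).1
  have h0 := (bddMeasurable_kernel hθ).comp hE
  have h1 := (bddMeasurable_kernelTime hθ).comp hE
  have h2 := (bddMeasurable_kernelSpace hθ).comp hE
  have hp := (hψ.continuous.bddMeasurable_of_hasCompactSupport hψc).comp hZ
  have hpt := (bddMeasurable_fderiv_apply hψ hψc (1, 0)).comp hZ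
  have hpx := (bddMeasurable_fderiv_apply hψ hψc (0, 1)).comp hZ
  exact (((hub.sub hwb).abs.mul ((hpt.mul h0).add (hp.mul (h1.div_const _)))).add
    ((hs.mul ((H.bddMeasurable_flux hZ hub.1).sub (H.bddMeasurable_flux hZ hwb.1))).mul
      ((hpx.mul h0).add (hp.mul (h2.div_const _))))).sub
    ((hs.mul (H.bddMeasurable_deriv_flux hZ hwb.1)).mul (hp.mul h0))

theorem bddMeasurable_doublingRight (H : SplitFluxRegular T L a b G Q) (hθ : Mollifier θ)
    (hu : Measurable u) (hu01 : ∀ z, u z ∈ Icc (0 : ℝ) 1)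
    (hw : Measurable w) (hw01 : ∀ z, w z ∈ Icc (0 : ℝ) 1)
    (hψ : ContDiff ℝ ∞ ψ) (hψc : HasCompactSupport ψ) {α : Type*}
    [MeasurableSpace α] {Z Z' E : α → ℝ × ℝ} (hZ : Measurable Z) (hZ' : Measurable Z')
    (hE : Measurable E) :
    BddMeasurable fun q => doublingRight θ h a b G Q u w ψ (Z q) (Z' q) (E q) := by
  have hub := (bddMeasurable_of_mem_Icc hu hu01).comp hZ
  have hwb := (bddMeasurable_of_mem_Icc hw hw01).comp hZ'
  have hs := BddMeasurable.sign (hwb.sub hub).1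
  have h0 := (bddMeasurable_kernel hθ).comp hE
  have h1 := (bddMeasurable_kernelTime hθ).comp hE
  have h2 := (bddMeasurable_kernelSpace hθ).comp hE
  have hp := (hψ.continuous.bddMeasurable_of_hasCompactSupport hψc).comp hZ
  exact (((hwb.sub hub).abs.mul (hp.mul (h1.div_const _)).neg).add
    ((hs.mul ((H.bddMeasurable_flux hZ' hwb.1).sub (H.bddMeasurable_flux hZ' hub.1))).mul
      (hp.mul (h2.div_const _)).neg)).sub
    ((hs.mul (H.bddMeasurable_deriv_flux hZ' hub.1)).mul (hp.mul h0))

theorem doublingLeft_eq_zero (hθ : Mollifier θ) {z e : ℝ × ℝ}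
    (hze : z ∉ tsupport ψ ∨ e ∉ Metric.closedBall (0 : ℝ × ℝ) 1) (z' : ℝ × ℝ) :
    doublingLeft θ h a b G Q u w ψ z z' e = 0 := by
  rcases hze with hz | he
  · simp [doublingLeft, image_eq_zero_of_notMem_tsupport hz,
      fderiv_apply_eq_zero_of_notMem_tsupport hz]
  · simp [doublingLeft, kernel_eq_zero hθ he]

theorem doublingRight_eq_zero (hθ : Mollifier θ) {z e : ℝ × ℝ}
    (hze : z ∉ tsupport ψ ∨ e ∉ Metric.closedBall (0 : ℝ × ℝ) 1) (z' : ℝ × ℝ) :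
    doublingRight θ h a b G Q u w ψ z z' e = 0 := by
  rcases hze with hz | he
  · simp [doublingRight, image_eq_zero_of_notMem_tsupport hz]
  · simp [doublingRight, kernel_eq_zero hθ he]

/-- The sum of the two entropy inequalities, integrated and written in scaled variables. -/
theorem integral_doubling_nonneg (H : SplitFluxRegular T L a b G Q) (hθ : Mollifier θ) (hh : 0 < h)
    (hu : Measurable u) (hu01 : ∀ z, u z ∈ Icc (0 : ℝ) 1)
    (hw : Measurable w) (hw01 : ∀ z, w z ∈ Icc (0 : ℝ) 1)
    (hue : IsEntropySolution T a b G Q u) (hwe : IsEntropySolution T a b G Q w)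
    (hψ : ContDiff ℝ ∞ ψ) (hψc : HasCompactSupport ψ)
    (hψs : tsupport ψ ⊆ Ioo 0 T ×ˢ univ) (hψ0 : ∀ z, 0 ≤ ψ z)
    (hsmall : ∀ z ∈ tsupport ψ, ∀ s, |s - z.1| ≤ h ^ 2 → s ∈ Ioo 0 T) :
    0 ≤ ∫ q : (ℝ × ℝ) × (ℝ × ℝ),
      (doublingLeft θ h a b G Q u w ψ q.1 (q.1 - scaling h q.2) q.2
        + doublingRight θ h a b G Q u w ψ q.1 (q.1 - scaling h q.2) q.2) := by
  have hE : Measurable fun q : (ℝ × ℝ) × (ℝ × ℝ) => unscaling h (q.1 - q.2) :=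
    (continuous_unscaling h).measurable.comp (measurable_fst.sub measurable_snd)
  have hI1 := bddMeasurable_doublingLeft (h := h) H hθ hu hu01 hw hw01 hψ hψc measurable_fst
    measurable_snd hE
  have hI2 := bddMeasurable_doublingRight (h := h) H hθ hu hu01 hw hw01 hψ hψc measurable_fst
    measurable_snd hE
  set s : Set ((ℝ × ℝ) × (ℝ × ℝ)) := (fun q => (q.1, q.1 - scaling h q.2)) ''
    (tsupport ψ ×ˢ Metric.closedBall (0 : ℝ × ℝ) 1) with hs
  have hsc : IsCompact s := (hψc.isCompact.prod (isCompact_closedBall 0 1)).image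
    (continuous_fst.prodMk (continuous_fst.sub ((continuous_scaling h).comp continuous_snd)))
  have hout : ∀ q, q ∉ s → q.1 ∉ tsupport ψ ∨
      unscaling h (q.1 - q.2) ∉ Metric.closedBall (0 : ℝ × ℝ) 1 := by
    intro q hq
    by_contra! hc
    refine hq ⟨(q.1, unscaling h (q.1 - q.2)), hc, ?_⟩
    simp [scaling_unscaling hh.ne']
  have hi1 := hI1.integrable (μ := (volume : Measure (ℝ × ℝ)).prod volume) hsc.measure_lt_top.ne
    fun q hq => doublingLeft_eq_zero hθ (hout q hq) _
  have hi2 := hI2.integrable (μ := (volume : Measure (ℝ × ℝ)).prod volume) hsc.measure_lt_top.ne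
    fun q hq => doublingRight_eq_zero hθ (hout q hq) _
  have hn1 : 0 ≤ ∫ q : (ℝ × ℝ) × (ℝ × ℝ),
      doublingLeft θ h a b G Q u w ψ q.1 q.2 (unscaling h (q.1 - q.2)) := by
    rw [Measure.volume_eq_prod, integral_prod_symm _ hi1]
    exact integral_nonneg fun z' =>
      integral_doublingLeft_nonneg hθ hue hw01 hψ hψc hψs hψ0 z'
  have hn2 : 0 ≤ ∫ q : (ℝ × ℝ) × (ℝ × ℝ),
      doublingRight θ h a b G Q u w ψ q.1 q.2 (unscaling h (q.1 - q.2)) := by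
    rw [Measure.volume_eq_prod, integral_prod _ hi2]
    exact integral_nonneg fun z => integral_doublingRight_nonneg hθ hh hwe hu01 hψ0 hsmall z
  have hn := add_nonneg hn1 hn2
  have hi12 : Integrable (fun q : (ℝ × ℝ) × (ℝ × ℝ) =>
      doublingLeft θ h a b G Q u w ψ q.1 q.2 (unscaling h (q.1 - q.2))
        + doublingRight θ h a b G Q u w ψ q.1 q.2 (unscaling h (q.1 - q.2)))
      ((volume : Measure (ℝ × ℝ)).prod volume) := hi1.add hi2
  rw [Measure.volume_eq_prod, ← integral_add hi1 hi2, integral_prod _ hi12] at hn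
  obtain ⟨c, hc, hcv⟩ := exists_integral_sub_scaling hh.ne'
  have hcm : Measurable fun q : (ℝ × ℝ) × (ℝ × ℝ) => q.1 - scaling h q.2 :=
    measurable_fst.sub ((continuous_scaling h).measurable.comp measurable_snd)
  have hJ := (bddMeasurable_doublingLeft (h := h) H hθ hu hu01 hw hw01 hψ hψc measurable_fst
    hcm measurable_snd).add (bddMeasurable_doublingRight (h := h) H hθ hu hu01 hw hw01 hψ hψc
      measurable_fst hcm measurable_snd)
  have hJi := hJ.integrable (μ := (volume : Measure (ℝ × ℝ)).prod volume)
    (s := tsupport ψ ×ˢ Metric.closedBall (0 : ℝ × ℝ) 1)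
    (hψc.isCompact.prod (isCompact_closedBall 0 1)).measure_lt_top.ne (fun q hq => by
      have hq' : q.1 ∉ tsupport ψ ∨ q.2 ∉ Metric.closedBall (0 : ℝ × ℝ) 1 := by
        by_contra! hc
        exact hq hc
      rw [doublingLeft_eq_zero hθ hq', doublingRight_eq_zero hθ hq', add_zero])
  rw [Measure.volume_eq_prod, integral_prod _ hJi]
  have hinner : ∀ z : ℝ × ℝ, (∫ e, (doublingLeft θ h a b G Q u w ψ z (z - scaling h e) e
        + doublingRight θ h a b G Q u w ψ z (z - scaling h e) e)) =
      c * ∫ z', (doublingLeft θ h a b G Q u w ψ z z' (unscaling h (z - z'))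
        + doublingRight θ h a b G Q u w ψ z z' (unscaling h (z - z'))) := by
    intro z
    rw [← hcv z]
    simp [unscaling_scaling hh.ne']
  simp only [hinner, integral_const_mul]
  exact mul_nonneg hc.le hn

/-- Regrouping of the two integrands: all singular factors act on differences. -/
theorem doubling_add_eq (hh : h ≠ 0) (z z' e : ℝ × ℝ) :
    doublingLeft θ h a b G Q u w ψ z z' e + doublingRight θ h a b G Q u w ψ z z' e =
      |u z - w z'| * (fderiv ℝ ψ z (1, 0) * kernel θ e)
      + (splitFlux a G Q z (max (u z) (w z')) - splitFlux a G Q z (min (u z) (w z')))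
        * (fderiv ℝ ψ z (0, 1) * kernel θ e)
      + ((a z - a z') / h * (G z.1 (max (u z) (w z')) - G z.1 (min (u z) (w z')))
        + Real.sign (u z - w z') * (a z' * (((G z.1 (u z) - G z'.1 (u z))
          - (G z.1 (w z') - G z'.1 (w z'))) / h))) * (ψ z * kernelSpace θ e)
      + (Real.sign (u z - w z') * ((b z' - b z) * G z'.1 (u z))
        + Real.sign (u z - w z') * (b z * (G z'.1 (u z) - G z.1 (u z)))
        + b z * (G z.1 (max (u z) (w z')) - G z.1 (min (u z) (w z')))) * (ψ z * kernel θ e) := by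
  rw [← sign_mul_sub_eq, ← sign_mul_sub_eq]
  have hsgn : Real.sign (w z' - u z) = -Real.sign (u z - w z') := by
    rw [← Real.sign_neg, neg_sub]
  -- The `kernelTime` terms, of order `1/h²`, cancel because `|u z - w z'|` is symmetric. `Q`
  -- cancels in the `kernelSpace` terms because it does not depend on the point.
  rw [doublingLeft, doublingRight, hsgn, abs_sub_comm (w z') (u z)]
  simp only [splitFlux]
  field_simp
  ring

end DoublingLimit

/-! ### Passage to the limit in the doubled inequality. -/

section Kato

variable {T L h : ℝ} {θ : ℝ → ℝ} {a b : ℝ × ℝ → ℝ} {G : ℝ → ℝ → ℝ} {Q : ℝ → ℝ}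
  {u w ψ : ℝ × ℝ → ℝ}

theorem abs_mul_mul_le {c p n M P N : ℝ} (hc : |c| ≤ M) (hp : |p| ≤ P) (hn : |n| ≤ N) :
    |c * (p * n)| ≤ M * (P * N) := by
  rw [abs_mul, abs_mul]
  have hM := (abs_nonneg _).trans hc
  have hP := (abs_nonneg _).trans hp
  exact mul_le_mul hc (mul_le_mul hp hn (abs_nonneg _) hP)
    (mul_nonneg (abs_nonneg _) (abs_nonneg _)) hM

theorem abs_sub_le_two_mul {x y M : ℝ} (hx : |x| ≤ M) (hy : |y| ≤ M) : |x - y| ≤ 2 * M :=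
  (abs_sub _ _).trans (by linarith)

theorem abs_mul_le {x y M N : ℝ} (hx : |x| ≤ M) (hy : |y| ≤ N) : |x * y| ≤ M * N := by
  rw [abs_mul]
  exact mul_le_mul hx hy (abs_nonneg _) ((abs_nonneg _).trans hx)

/-- Bound, uniform in the scale, for the doubled integrand. -/
theorem abs_doubling_le (H : SplitFluxRegular T L a b G Q) (hθ : Mollifier θ) (hh : 0 < h)
    (hh1 : h ≤ 1) (hu01 : ∀ z, u z ∈ Icc (0 : ℝ) 1) (hw01 : ∀ z, w z ∈ Icc (0 : ℝ) 1)
    (z e : ℝ × ℝ) :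
    |doublingLeft θ h a b G Q u w ψ z (z - scaling h e) e
        + doublingRight θ h a b G Q u w ψ z (z - scaling h e) e| ≤
      (1 + 2 * (L * L + L) + (2 * L * (2 * L) + 1 * (L * (2 * L)))
        + (1 * (2 * L * L) + 1 * (L * (2 * L)) + L * (2 * L))) *
      ((|fderiv ℝ ψ z (1, 0)| + |fderiv ℝ ψ z (0, 1)| + |ψ z|)
        * (|kernel θ e| + |kernelSpace θ e|)) := by
  have hL := H.nonneg
  by_cases he : e ∈ Metric.closedBall (0 : ℝ × ℝ) 1
  swap
  · rw [doublingLeft_eq_zero hθ (Or.inr he), doublingRight_eq_zero hθ (Or.inr he)]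
    simp only [add_zero, abs_zero]
    positivity
  have he' : |e.1| ≤ 1 ∧ |e.2| ≤ 1 := by simpa [Prod.norm_def] using he
  rw [doubling_add_eq hh.ne']
  set z' := z - scaling h e with hz'
  -- This is the purpose of the time width `h²`: a time increment divided by `h` is still at most
  -- `h`, so Lipschitz dependence on time suffices.
  have hd1 : |z.1 - z'.1| ≤ h * h := by
    have : z.1 - z'.1 = h ^ 2 * e.1 := by simp [hz', scaling]
    rw [this, abs_mul, abs_of_pos (pow_pos hh 2)]
    nlinarith [he'.1, sq_nonneg h]
  have hd2 : |z.2 - z'.2| ≤ h := by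
    have : z.2 - z'.2 = h * e.2 := by simp [hz', scaling]
    rw [this, abs_mul, abs_of_pos hh]
    nlinarith [he'.2]
  have hhh : h * h ≤ h := by nlinarith
  have hq : |(a z - a z') / h| ≤ 2 * L := by
    rw [abs_div, abs_of_pos hh, div_le_iff₀ hh]
    refine (H.a_lip z z').trans ?_
    nlinarith [mul_le_mul_of_nonneg_left (add_le_add (hd1.trans hhh) hd2) hL]
  have hGt : ∀ r, |G z.1 r - G z'.1 r| ≤ L * h := fun r =>
    (H.G_time _ _ _).trans (mul_le_mul_of_nonneg_left (hd1.trans hhh) hL)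
  have hGG : |((G z.1 (u z) - G z'.1 (u z)) - (G z.1 (w z') - G z'.1 (w z'))) / h| ≤ 2 * L := by
    rw [abs_div, abs_of_pos hh, div_le_iff₀ hh]
    exact (abs_sub_le_two_mul (hGt _) (hGt _)).trans_eq (by ring)
  have hG2 : ∀ t s r r', |G t r - G s r'| ≤ 2 * L := fun t s r r' =>
    abs_sub_le_two_mul (H.G_bdd _ _) (H.G_bdd _ _)
  have hS := abs_sign_le_one (u z - w z')
  have huw : |u z - w z'| ≤ 1 := by
    rw [abs_le]
    constructor <;> linarith [(hu01 z).1, (hu01 z).2, (hw01 z').1, (hw01 z').2]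
  have hP1 : |fderiv ℝ ψ z (1, 0)| ≤
      |fderiv ℝ ψ z (1, 0)| + |fderiv ℝ ψ z (0, 1)| + |ψ z| := by
    linarith [abs_nonneg (fderiv ℝ ψ z (0, 1)), abs_nonneg (ψ z)]
  have hP2 : |fderiv ℝ ψ z (0, 1)| ≤
      |fderiv ℝ ψ z (1, 0)| + |fderiv ℝ ψ z (0, 1)| + |ψ z| := by
    linarith [abs_nonneg (fderiv ℝ ψ z (1, 0)), abs_nonneg (ψ z)]
  have hP3 : |ψ z| ≤ |fderiv ℝ ψ z (1, 0)| + |fderiv ℝ ψ z (0, 1)| + |ψ z| := by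
    linarith [abs_nonneg (fderiv ℝ ψ z (1, 0)), abs_nonneg (fderiv ℝ ψ z (0, 1))]
  have hN1 : |kernel θ e| ≤ |kernel θ e| + |kernelSpace θ e| := by
    linarith [abs_nonneg (kernelSpace θ e)]
  have hN2 : |kernelSpace θ e| ≤ |kernel θ e| + |kernelSpace θ e| := by
    linarith [abs_nonneg (kernel θ e)]
  set P := |fderiv ℝ ψ z (1, 0)| + |fderiv ℝ ψ z (0, 1)| + |ψ z|
  set N := |kernel θ e| + |kernelSpace θ e|
  have hsplit : ∀ M₁ M₂ M₃ M₄ : ℝ, (M₁ + M₂ + M₃ + M₄) * (P * N) =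
      M₁ * (P * N) + M₂ * (P * N) + M₃ * (P * N) + M₄ * (P * N) := fun _ _ _ _ => by ring
  rw [hsplit]
  refine (abs_add_le _ _).trans (add_le_add ((abs_add_le _ _).trans (add_le_add
    ((abs_add_le _ _).trans (add_le_add ?_ ?_)) ?_)) ?_)
  · exact abs_mul_mul_le (by rwa [abs_abs]) hP1 hN1
  · exact abs_mul_mul_le (abs_sub_le_two_mul (H.flux_bdd _ _) (H.flux_bdd _ _)) hP2 hN1
  · exact abs_mul_mul_le ((abs_add_le _ _).trans (add_le_add (abs_mul_le hq (hG2 _ _ _ _))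
      (abs_mul_le hS (abs_mul_le (H.a_bdd _) hGG)))) hP3 hN2
  · refine abs_mul_mul_le ((abs_add_le _ _).trans (add_le_add ((abs_add_le _ _).trans
      (add_le_add (abs_mul_le hS (abs_mul_le ?_ (H.G_bdd _ _)))
        (abs_mul_le hS (abs_mul_le (H.b_bdd _) (hG2 _ _ _ _)))))
      (abs_mul_le (H.b_bdd _) (hG2 _ _ _ _)))) hP3 hN1
    exact abs_sub_le_two_mul (H.b_bdd _) (H.b_bdd _)

theorem tendsto_scaling_zero {ι : Type*} {l : Filter ι} {η : ι → ℝ} (hη : Tendsto η l (𝓝 0))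
    (e : ℝ × ℝ) : Tendsto (fun n => scaling (η n) e) l (𝓝 0) := by
  have : Continuous fun h : ℝ => scaling h e := by unfold scaling; fun_prop
  have h0 : scaling 0 e = 0 := by simp [scaling]
  exact h0 ▸ (this.tendsto 0).comp hη

/-- The curve `h ↦ z - (h² τ, h ξ)` has velocity `-(0, ξ)` at `h = 0`, so only the space derivative
of `a` survives. -/
theorem tendsto_slope_scaling {A : ℝ × ℝ →L[ℝ] ℝ} {z : ℝ × ℝ} (hA : HasFDerivAt a A z)
    {η : ℕ → ℝ} (hη : Tendsto η atTop (𝓝 0)) (hpos : ∀ n, 0 < η n) (e : ℝ × ℝ) :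
    Tendsto (fun n => (a z - a (z - scaling (η n) e)) / η n) atTop (𝓝 (e.2 * A (0, 1))) := by
  have hc : HasDerivAt (fun h : ℝ => z - scaling h e) (-(0, e.2)) 0 := by
    have h1 : HasDerivAt (fun h : ℝ => h ^ 2 * e.1) 0 0 := by
      simpa using ((hasDerivAt_pow 2 (0 : ℝ)).mul_const e.1)
    have h2 : HasDerivAt (fun h : ℝ => h * e.2) e.2 0 := by
      simpa using ((hasDerivAt_id (0 : ℝ)).mul_const e.2)
    exact (h1.prodMk h2).const_sub z
  have hz : z - scaling 0 e = z := by simp [scaling]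
  have hA' : HasFDerivAt a A (z - scaling 0 e) := by rwa [hz]
  have h3 := (hA'.comp_hasDerivAt (0 : ℝ) hc).tendsto_slope_zero
  have h4 : Tendsto η atTop (𝓝[≠] 0) :=
    tendsto_nhdsWithin_iff.2 ⟨hη, Eventually.of_forall fun n => (hpos n).ne'⟩
  have h5 := (h3.comp h4).neg
  have hval : -(A (-(0, e.2))) = e.2 * A (0, 1) := by
    have : (0, e.2) = e.2 • ((0, 1) : ℝ × ℝ) := by simp
    rw [map_neg, neg_neg, this, map_smul, smul_eq_mul]
  rw [hval] at h5
  refine h5.congr fun n => ?_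
  simp only [Function.comp_apply, zero_add, hz, smul_eq_mul]
  field_simp
  ring

/-- Pointwise limit of the doubled integrand. -/
theorem tendsto_doubling (H : SplitFluxRegular T L a b G Q) {z : ℝ × ℝ} (hz : z.1 ∈ Ioo 0 T)
    {η : ℕ → ℝ} (hη : Tendsto η atTop (𝓝 0)) (hpos : ∀ n, 0 < η n) (e : ℝ × ℝ)
    (hw : Tendsto (fun n => w (z - scaling (η n) e)) atTop (𝓝 (w z))) :
    Tendsto (fun n => doublingLeft θ (η n) a b G Q u w ψ z (z - scaling (η n) e) e
        + doublingRight θ (η n) a b G Q u w ψ z (z - scaling (η n) e) e) atTop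
      (𝓝 (|u z - w z| * (fderiv ℝ ψ z (1, 0) * kernel θ e)
      + (splitFlux a G Q z (max (u z) (w z)) - splitFlux a G Q z (min (u z) (w z)))
        * (fderiv ℝ ψ z (0, 1) * kernel θ e)
      + (e.2 * b z * (G z.1 (max (u z) (w z)) - G z.1 (min (u z) (w z))) + 0)
        * (ψ z * kernelSpace θ e)
      + (0 + 0 + b z * (G z.1 (max (u z) (w z)) - G z.1 (min (u z) (w z))))
        * (ψ z * kernel θ e))) := by
  simp only [fun n => doubling_add_eq (θ := θ) (a := a) (b := b) (G := G) (Q := Q) (u := u)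
    (w := w) (ψ := ψ) (hpos n).ne' z (z - scaling (η n) e) e]
  have hz' : Tendsto (fun n => z - scaling (η n) e) atTop (𝓝 z) := by
    simpa using tendsto_const_nhds.sub (tendsto_scaling_zero hη e)
  have hmax : Tendsto (fun n => max (u z) (w (z - scaling (η n) e))) atTop
      (𝓝 (max (u z) (w z))) := tendsto_const_nhds.max hw
  have hmin : Tendsto (fun n => min (u z) (w (z - scaling (η n) e))) atTop
      (𝓝 (min (u z) (w z))) := tendsto_const_nhds.min hw
  have hFc : Continuous fun r => splitFlux a G Q z r :=
    H.flux_cont.comp (continuous_const.prodMk continuous_id)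
  have hGc : Continuous fun r => G z.1 r := H.G_cont.comp (continuous_const.prodMk continuous_id)
  have hΔF := ((hFc.tendsto _).comp hmax).sub ((hFc.tendsto _).comp hmin)
  have hΔG := ((hGc.tendsto _).comp hmax).sub ((hGc.tendsto _).comp hmin)
  obtain ⟨A, hA, hAb⟩ := H.a_diff z hz
  have hslope := tendsto_slope_scaling hA hη hpos e
  rw [hAb] at hslope
  have hL := H.nonneg
  have hd1 : ∀ n, |z.1 - (z - scaling (η n) e).1| = η n ^ 2 * |e.1| := fun n => by
    simp [scaling, abs_mul]
  have hGt : ∀ n r, |G z.1 r - G (z - scaling (η n) e).1 r| ≤ L * (η n ^ 2 * |e.1|) :=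
    fun n r => (H.G_time _ _ _).trans_eq (by rw [hd1])
  -- In the three remainders the sign multiplies quantities that vanish in the limit, so its
  -- discontinuity is harmless. Here the factor is at most `2 L h² |τ| / h`, up to the bound on `a`.
  have hrem1 : Tendsto (fun n => Real.sign (u z - w (z - scaling (η n) e)) *
      (a (z - scaling (η n) e) * (((G z.1 (u z) - G (z - scaling (η n) e).1 (u z))
        - (G z.1 (w (z - scaling (η n) e))
          - G (z - scaling (η n) e).1 (w (z - scaling (η n) e)))) / η n))) atTop (𝓝 0) := by
    refine squeeze_zero_norm (a := fun n => 1 * (L * (2 * (L * (η n * |e.1|))))) (fun n => ?_) ?_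
    · refine abs_mul_le (abs_sign_le_one _) (abs_mul_le (H.a_bdd _) ?_)
      rw [abs_div, abs_of_pos (hpos n), div_le_iff₀ (hpos n)]
      exact (abs_sub_le_two_mul (hGt n _) (hGt n _)).trans_eq (by ring)
    · have : Continuous fun s : ℝ => 1 * (L * (2 * (L * (s * |e.1|)))) := by fun_prop
      simpa [Function.comp_def] using (this.tendsto 0).comp hη
  have hrem2 : Tendsto (fun n => Real.sign (u z - w (z - scaling (η n) e)) *
      ((b (z - scaling (η n) e) - b z) * G (z - scaling (η n) e).1 (u z))) atTop (𝓝 0) := by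
    refine squeeze_zero_norm (a := fun n => 1 * (|b (z - scaling (η n) e) - b z| * L))
      (fun n => ?_) ?_
    · exact abs_mul_le (abs_sign_le_one _) (abs_mul_le le_rfl (H.G_bdd _ _))
    · have h1 := ((H.b_cont.tendsto z).comp hz').sub_const (b z)
      have h2 := (h1.abs.mul_const L).const_mul 1
      simpa using h2
  have hrem3 : Tendsto (fun n => Real.sign (u z - w (z - scaling (η n) e)) *
      (b z * (G (z - scaling (η n) e).1 (u z) - G z.1 (u z)))) atTop (𝓝 0) := by
    refine squeeze_zero_norm (a := fun n => 1 * (L * (L * (η n ^ 2 * |e.1|)))) (fun n => ?_) ?_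
    · refine abs_mul_le (abs_sign_le_one _) (abs_mul_le (H.b_bdd _) ?_)
      rw [abs_sub_comm]
      exact hGt n _
    · have : Continuous fun s : ℝ => 1 * (L * (L * (s ^ 2 * |e.1|))) := by fun_prop
      simpa [Function.comp_def] using (this.tendsto 0).comp hη
  exact ((((tendsto_const_nhds.sub hw).abs.mul_const _).add (hΔF.mul_const _)).add
    (((hslope.mul hΔG).add hrem1).mul_const _)).add
    (((hrem2.add hrem3).add (hΔG.const_mul (b z))).mul_const _)

theorem integral_kernel (hθ : Mollifier θ) : ∫ e, kernel θ e = 1 := by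
  simp only [kernel]
  rw [Measure.volume_eq_prod, integral_prod_mul, hθ.integral_eq_one, mul_one]

theorem integrable_kernel (hθ : Mollifier θ) : Integrable (kernel θ) :=
  (contDiff_kernel hθ).continuous.integrable_of_hasCompactSupport (hasCompactSupport_kernel hθ)

theorem integrable_snd_mul_kernelSpace (hθ : Mollifier θ) :
    Integrable fun e : ℝ × ℝ => e.2 * kernelSpace θ e :=
  (continuous_snd.mul (continuous_kernelSpace hθ)).integrable_of_hasCompactSupport
    (hasCompactSupport_kernelSpace hθ).mul_left

/-- This identity removes the zero-order terms: the variation of `a` in space balances the source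
terms exactly. -/
theorem integral_snd_mul_kernelSpace_add_kernel (hθ : Mollifier θ) :
    ∫ e : ℝ × ℝ, (e.2 * kernelSpace θ e + kernel θ e) = 0 := by
  rw [integral_add (integrable_snd_mul_kernelSpace hθ) (integrable_kernel hθ), integral_kernel hθ]
  have : ∫ e : ℝ × ℝ, e.2 * kernelSpace θ e = ∫ e : ℝ × ℝ, θ e.1 * (e.2 * deriv θ e.2) :=
    integral_congr_ae (Eventually.of_forall fun e => by simp only [kernelSpace]; ring)
  rw [this, Measure.volume_eq_prod, integral_prod_mul (fun x => θ x) (fun x => x * deriv θ x),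
    hθ.integral_eq_one, hθ.integral_id_mul_deriv]
  norm_num

/-- **Kato's inequality** for two entropy solutions. -/
theorem kato_inequality (H : SplitFluxRegular T L a b G Q)
    (hu : Measurable u) (hu01 : ∀ z, u z ∈ Icc (0 : ℝ) 1)
    (hw : Measurable w) (hw01 : ∀ z, w z ∈ Icc (0 : ℝ) 1)
    (hue : IsEntropySolution T a b G Q u) (hwe : IsEntropySolution T a b G Q w)
    (hψ : ContDiff ℝ ∞ ψ) (hψc : HasCompactSupport ψ)
    (hψs : tsupport ψ ⊆ Ioo 0 T ×ˢ univ) (hψ0 : ∀ z, 0 ≤ ψ z) :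
    0 ≤ ∫ z, (|u z - w z| * fderiv ℝ ψ z (1, 0)
      + (splitFlux a G Q z (max (u z) (w z)) - splitFlux a G Q z (min (u z) (w z)))
        * fderiv ℝ ψ z (0, 1)) := by
  obtain ⟨θ, hθ⟩ := exists_mollifier
  obtain ⟨δ, hδ, hδs⟩ : ∃ δ > 0, ∀ z ∈ tsupport ψ, ∀ s, |s - z.1| ≤ δ → s ∈ Ioo 0 T := by
    have hK : IsCompact (Prod.fst '' tsupport ψ) := hψc.isCompact.image continuous_fst
    obtain ⟨δ, hδ, hsub⟩ := hK.exists_cthickening_subset_open (isOpen_Ioo (a := 0) (b := T))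
      (by rintro _ ⟨z, hz, rfl⟩; exact (hψs hz).1)
    exact ⟨δ, hδ, fun z hz s hs => hsub
      (Metric.mem_cthickening_of_dist_le s z.1 δ _ (mem_image_of_mem _ hz) hs)⟩
  obtain ⟨R, -, hR⟩ := hψc.isCompact.isBounded.subset_ball_lt 0 0
  set η₀ : ℕ → ℝ := fun n => 1 / ((n : ℝ) + 1) with hη₀
  have hη₀lim : Tendsto η₀ atTop (𝓝 0) := tendsto_one_div_add_atTop_nhds_zero_nat
  have hη₀pos : ∀ n, 0 < η₀ n := fun n => Nat.one_div_pos_of_nat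
  have hη₀le : ∀ n, η₀ n ≤ 1 := fun n => by
    rw [hη₀, div_le_one (by positivity)]
    linarith [n.cast_nonneg (α := ℝ)]
  have : IsFiniteMeasure ((volume : Measure (ℝ × ℝ)).restrict (Metric.closedBall 0 1)) :=
    ⟨by rw [Measure.restrict_apply_univ]; exact measure_closedBall_lt_top⟩
  -- Convergence is needed only for `z` in the support of `ψ` and `e` in that of the kernel. A
  -- subsequence of scales is enough, since the inequality holds at every small scale.
  obtain ⟨ns, hns, hae⟩ := exists_seq_tendsto_ae_translate hw
    (fun z => abs_le.2 ⟨by linarith [(hw01 z).1], (hw01 z).2⟩) (fun n => scaling (η₀ n))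
    (fun n => continuous_scaling _) (fun e => tendsto_scaling_zero hη₀lim e) R
    (volume.restrict (Metric.closedBall 0 1))
  set η : ℕ → ℝ := fun n => η₀ (ns n) with hηdef
  have hη : Tendsto η atTop (𝓝 0) := hη₀lim.comp hns.tendsto_atTop
  have hpos : ∀ n, 0 < η n := fun n => hη₀pos _
  have hle : ∀ n, η n ≤ 1 := fun n => hη₀le _
  set A : ℝ × ℝ → ℝ := fun z => |u z - w z| * fderiv ℝ ψ z (1, 0)
      + (splitFlux a G Q z (max (u z) (w z)) - splitFlux a G Q z (min (u z) (w z)))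
        * fderiv ℝ ψ z (0, 1) with hA
  set B : ℝ × ℝ → ℝ := fun z =>
    (b z * G z.1 (max (u z) (w z)) - b z * G z.1 (min (u z) (w z))) * ψ z with hB
  have hae' : ∀ᵐ q : (ℝ × ℝ) × (ℝ × ℝ), q.1 ∈ Metric.ball (0 : ℝ × ℝ) R →
      q.2 ∈ Metric.closedBall (0 : ℝ × ℝ) 1 →
        Tendsto (fun n => w (q.1 - scaling (η n) q.2)) atTop (𝓝 (w q.1)) := by
    have h1 : (volume : Measure (ℝ × ℝ)).prod (volume.restrict (Metric.closedBall 0 1)) =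
        (volume : Measure ((ℝ × ℝ) × (ℝ × ℝ))).restrict
          (univ ×ˢ Metric.closedBall (0 : ℝ × ℝ) 1) := by
      rw [Measure.volume_eq_prod (ℝ × ℝ), ← Measure.prod_restrict, Measure.restrict_univ]
    rw [h1, ae_restrict_iff' (MeasurableSet.univ.prod Metric.isClosed_closedBall.measurableSet)]
      at hae
    filter_upwards [hae] with q hq h2 h3
    exact hq ⟨mem_univ _, h3⟩ h2
  have hlim : Tendsto (fun n => ∫ q : (ℝ × ℝ) × (ℝ × ℝ),
      (doublingLeft θ (η n) a b G Q u w ψ q.1 (q.1 - scaling (η n) q.2) q.2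
        + doublingRight θ (η n) a b G Q u w ψ q.1 (q.1 - scaling (η n) q.2) q.2)) atTop
      (𝓝 (∫ q : (ℝ × ℝ) × (ℝ × ℝ),
        (A q.1 * kernel θ q.2 + B q.1 * (q.2.2 * kernelSpace θ q.2 + kernel θ q.2)))) := by
    refine tendsto_integral_of_dominated_convergence _ (fun n => ?_) ?_
      (fun n => Eventually.of_forall fun q =>
        abs_doubling_le H hθ (hpos n) (hle n) hu01 hw01 q.1 q.2) ?_
    · have hcm : Measurable fun q : (ℝ × ℝ) × (ℝ × ℝ) => q.1 - scaling (η n) q.2 :=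
        measurable_fst.sub ((continuous_scaling _).measurable.comp measurable_snd)
      exact ((bddMeasurable_doublingLeft H hθ hu hu01 hw hw01 hψ hψc measurable_fst
        hcm measurable_snd).add (bddMeasurable_doublingRight H hθ hu hu01 hw hw01 hψ hψc
        measurable_fst hcm measurable_snd)).1.aestronglyMeasurable
    · refine Integrable.const_mul ?_ _
      rw [Measure.volume_eq_prod]
      refine Integrable.mul_prod (f := fun z => |fderiv ℝ ψ z (1, 0)| + |fderiv ℝ ψ z (0, 1)|
        + |ψ z|) (g := fun e => |kernel θ e| + |kernelSpace θ e|) ?_ ?_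
      · exact ((((continuous_fderiv_apply_const hψ _).integrable_of_hasCompactSupport
          (hψc.fderiv_apply ℝ _)).abs).add
          (((continuous_fderiv_apply_const hψ _).integrable_of_hasCompactSupport
          (hψc.fderiv_apply ℝ _)).abs)).add
          (hψ.continuous.integrable_of_hasCompactSupport hψc).abs
      · exact (integrable_kernel hθ).abs.add
          ((continuous_kernelSpace hθ).integrable_of_hasCompactSupport
            (hasCompactSupport_kernelSpace hθ)).abs
    · filter_upwards [hae'] with q hq
      by_cases hq' : q.1 ∉ tsupport ψ ∨ q.2 ∉ Metric.closedBall (0 : ℝ × ℝ) 1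
      · have h0 : A q.1 * kernel θ q.2 + B q.1 * (q.2.2 * kernelSpace θ q.2 + kernel θ q.2) = 0 := by
          rcases hq' with hz | he
          · simp [hA, hB, image_eq_zero_of_notMem_tsupport hz,
              fderiv_apply_eq_zero_of_notMem_tsupport hz]
          · simp [kernel_eq_zero hθ he]
        rw [h0]
        simp only [doublingLeft_eq_zero hθ hq', doublingRight_eq_zero hθ hq', add_zero]
        exact tendsto_const_nhds
      · push Not at hq'
        have := tendsto_doubling (θ := θ) (u := u) (ψ := ψ) H (hψs hq'.1).1 hη hpos q.2
          (hq (hR hq'.1) hq'.2)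
        convert this using 2
        simp only [hA, hB]
        ring
  have hnn := ge_of_tendsto hlim (by
    filter_upwards [((continuous_pow 2).tendsto (0 : ℝ)).comp hη |>.eventually
      (gt_mem_nhds (show (0 : ℝ) ^ 2 < δ by simpa using hδ))] with n hn
    exact integral_doubling_nonneg H hθ (hpos n) hu hu01 hw hw01 hue hwe hψ hψc hψs hψ0
      fun z hz s hs => hδs z hz s (hs.trans (le_of_lt hn)))
  have hub := bddMeasurable_of_mem_Icc hu hu01
  have hwb := bddMeasurable_of_mem_Icc hw hw01
  have hψb := hψ.continuous.bddMeasurable_of_hasCompactSupport hψc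
  have hAi : Integrable A := by
    refine BddMeasurable.integrable (s := tsupport ψ) ?_ hψc.isCompact.measure_lt_top.ne
      (fun z hz => by simp [hA, fderiv_apply_eq_zero_of_notMem_tsupport hz])
    exact ((hub.sub hwb).abs.mul (bddMeasurable_fderiv_apply hψ hψc _)).add
      (((H.bddMeasurable_flux measurable_id (hu.max hw)).sub
        (H.bddMeasurable_flux measurable_id (hu.min hw))).mul
        (bddMeasurable_fderiv_apply hψ hψc _))
  have hBi : Integrable B := by
    refine BddMeasurable.integrable (s := tsupport ψ) ?_ hψc.isCompact.measure_lt_top.ne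
      (fun z hz => by simp [hB, image_eq_zero_of_notMem_tsupport hz])
    exact ((H.bddMeasurable_deriv_flux measurable_id (hu.max hw)).sub
        (H.bddMeasurable_deriv_flux measurable_id (hu.min hw))).mul hψb
  have hk : Integrable fun e : ℝ × ℝ => e.2 * kernelSpace θ e + kernel θ e :=
    (integrable_snd_mul_kernelSpace hθ).add (integrable_kernel hθ)
  -- Both limit terms are products of a function of `z` and a function of `e`. The factor of `A`
  -- integrates to `1` and that of `B` to `0`.
  rw [Measure.volume_eq_prod, integral_add (hAi.mul_prod (integrable_kernel hθ))
    (hBi.mul_prod hk), integral_prod_mul A (kernel θ),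
    integral_prod_mul B (fun e : ℝ × ℝ => e.2 * kernelSpace θ e + kernel θ e),
    integral_kernel hθ, integral_snd_mul_kernelSpace_add_kernel hθ, mul_one, mul_zero,
    add_zero] at hnn
  exact hnn

end Kato

/-! ### Weakly decreasing functions on an interval -/

/-- A smooth probability density supported in `(p,q)` has a smooth monotone primitive. -/
theorem exists_smooth_step {β : ℝ → ℝ} {p q : ℝ} (hβ : ContDiff ℝ ∞ β) (hβ0 : ∀ t, 0 ≤ β t)
    (hβ1 : ∫ t, β t = 1) (hs : Function.support β ⊆ Ioo p q) :
    ∃ s : ℝ → ℝ, ContDiff ℝ ∞ s ∧ deriv s = β ∧ Monotone s ∧ (∀ t ≤ p, s t = 0) ∧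
      ∀ t, q ≤ t → s t = 1 := by
  have hd : ∀ t, HasDerivAt (fun t => ∫ x in p..t, β x) (β t) t := fun t =>
    intervalIntegral.integral_hasDerivAt_right (hβ.continuous.intervalIntegrable _ _)
      (hβ.continuous.stronglyMeasurableAtFilter _ _) hβ.continuous.continuousAt
  have hderiv : deriv (fun t => ∫ x in p..t, β x) = β := funext fun t => (hd t).deriv
  have hdiff : Differentiable ℝ (fun t => ∫ x in p..t, β x) := fun t => (hd t).differentiableAt
  refine ⟨fun t => ∫ x in p..t, β x, contDiff_infty_iff_deriv.2 ⟨hdiff, by rwa [hderiv]⟩, hderiv,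
    monotone_of_deriv_nonneg hdiff fun t => by rw [hderiv]; exact hβ0 t, fun t ht => ?_,
    fun t ht => ?_⟩
  · have : EqOn β (fun _ => 0) (uIcc p t) := fun x hx => by
      rw [uIcc_of_ge ht] at hx
      by_contra hc
      exact absurd (hs hc).1 (not_lt.2 hx.2)
    simp [intervalIntegral.integral_congr this]
  · have : Function.support β ⊆ Ioc p t := hs.trans fun x hx => ⟨hx.1, hx.2.le.trans ht⟩
    exact (intervalIntegral.integral_eq_integral_of_support_subset this).trans hβ1

/-- If `D' ≤ 0` on `(0,T)` in the sense of distributions, and `D` is almost bounded by `D₀` near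
`0`, then `D ≤ D₀` almost everywhere on `(0,T)`. -/
theorem ae_le_of_weakly_decreasing {T D₀ : ℝ} {D : ℝ → ℝ} (hD : BddMeasurable D)
    (hmono : ∀ θ : ℝ → ℝ, ContDiff ℝ ∞ θ → HasCompactSupport θ → tsupport θ ⊆ Ioo 0 T →
      (∀ t, 0 ≤ θ t) → 0 ≤ ∫ t, deriv θ t * D t)
    (hnear : ∀ ε > 0, ∃ δ > 0, ∀ᵐ s, s ∈ Ioo 0 δ → D s ≤ D₀ + ε) :
    ∀ᵐ t, t ∈ Ioo 0 T → D t ≤ D₀ := by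
  obtain ⟨hDm, C, hC⟩ := hD
  have hloc : LocallyIntegrable D volume := by
    refine (locallyIntegrable_const C).mono hDm.aestronglyMeasurable
      (Eventually.of_forall fun t => ?_)
    exact (hC t).trans (le_abs_self _)
  have hmul : ∀ {γ : ℝ → ℝ}, Integrable γ → Integrable fun t => γ t * D t := fun hγ =>
    hγ.mul_bdd hDm.aestronglyMeasurable (Eventually.of_forall hC)
  let φ : ℕ → ContDiffBump (0 : ℝ) := fun n =>
    ⟨1 / ((n : ℝ) + 1) / 2, 1 / ((n : ℝ) + 1), by positivity,
      half_lt_self Nat.one_div_pos_of_nat⟩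
  have hφ : Tendsto (fun n => (φ n).rOut) atTop (𝓝 0) := tendsto_one_div_add_atTop_nhds_zero_nat
  have hφ' : ∀ᶠ n in atTop, (φ n).rOut ≤ 2 * (φ n).rIn := Eventually.of_forall fun n => by
    simp only [φ]
    linarith
  filter_upwards [ContDiffBump.ae_convolution_tendsto_right_of_locallyIntegrable hφ hφ' hloc]
    with t₀ hconv ht₀
  refine le_of_forall_pos_le_add fun ε hε => ?_
  obtain ⟨δ, hδ, hbound⟩ := hnear ε hε
  refine le_of_tendsto hconv ?_
  have hc : 0 < min δ t₀ / 4 := by have := lt_min hδ ht₀.1; linarith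
  have hcδ : min δ t₀ ≤ δ := min_le_left _ _
  have hct : min δ t₀ ≤ t₀ := min_le_right _ _
  -- With this `c` the density `A` lives in `(c/2, 2c)`, inside `(0, δ)` and to the left of `t₀/2`,
  -- hence of the bump around `t₀`, whose radius is below `t₀/2`.
  set c := min δ t₀ / 4 with hcdef
  let A : ContDiffBump c := ⟨c / 4, c / 2, by linarith, by linarith⟩
  have hAs : Function.support (A.normed volume) ⊆ Ioo (c / 2) (2 * c) := by
    rw [A.support_normed_eq, Real.ball_eq_Ioo]
    exact Ioo_subset_Ioo (by simp only [A]; linarith) (by simp only [A]; linarith)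
  obtain ⟨sA, hsA, hsAd, hsAm, hsA0, hsA1⟩ := exists_smooth_step A.contDiff_normed
    (fun t => A.nonneg_normed t) A.integral_normed hAs
  filter_upwards [hφ.eventually (gt_mem_nhds (show 0 < min (t₀ / 2) ((T - t₀) / 2) from
    lt_min (by linarith [ht₀.1]) (by linarith [ht₀.2])))] with n hn
  set r := (φ n).rOut with hr
  have hr0 : 0 < r := (φ n).rOut_pos
  have hr1 : r < t₀ / 2 := hn.trans_le (min_le_left _ _)
  have hr2 : r < (T - t₀) / 2 := hn.trans_le (min_le_right _ _)
  rw [convolution_lsmul_swap]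
  set β : ℝ → ℝ := fun t => (φ n).normed volume (t₀ - t) with hβ
  have hβc : ContDiff ℝ ∞ β := (φ n).contDiff_normed.comp (contDiff_const.sub contDiff_id)
  have hβs : Function.support β ⊆ Ioo (t₀ - r) (t₀ + r) := by
    intro t ht
    have : t₀ - t ∈ Function.support ((φ n).normed volume) := ht
    rw [(φ n).support_normed_eq, Real.ball_eq_Ioo] at this
    constructor <;> linarith [this.1, this.2]
  have hβ1 : ∫ t, β t = 1 := by
    rw [hβ, integral_sub_left_eq_self (fun t => (φ n).normed volume t)]
    exact (φ n).integral_normed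
  obtain ⟨sB, hsB, hsBd, hsBm, hsB0, hsB1⟩ := exists_smooth_step hβc
    (fun t => (φ n).nonneg_normed _) hβ1 hβs
  have hsub : Function.support (fun t => sA t - sB t) ⊆ Icc (c / 2) (t₀ + r) := by
    intro t ht
    by_contra hc'
    rw [mem_Icc, not_and_or, not_le, not_le] at hc'
    apply ht
    rcases hc' with h | h
    · simp [hsA0 t h.le, hsB0 t (by linarith)]
    · simp [hsA1 t (by linarith), hsB1 t h.le]
  have hts := closure_minimal hsub isClosed_Icc
  -- The test function rises from `0` to `1` near time `c` and falls back near `t₀`. Its derivative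
  -- is a difference of two densities, so the average of `D` near `t₀` is at most its average near
  -- `c`.
  have key := hmono (fun t => sA t - sB t) (hsA.sub hsB)
    (isCompact_Icc.of_isClosed_subset (isClosed_tsupport _) hts)
    (hts.trans fun t ht => ⟨by linarith [ht.1], by linarith [ht.2, ht₀.2]⟩)
    (fun t => by
      rcases le_total t (t₀ - r) with h | h
      · rw [hsB0 t h, sub_zero, ← hsA0 (c / 2) le_rfl]
        rcases le_total t (c / 2) with h' | h'
        · rw [hsA0 t h', hsA0 _ le_rfl]
        · exact hsAm h'
      · rw [hsA1 t (by linarith), sub_nonneg, ← hsB1 (max t (t₀ + r)) (le_max_right _ _)]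
        exact hsBm (le_max_left _ _))
  have hder : ∀ t, deriv (fun t => sA t - sB t) t = A.normed volume t - β t := fun t => by
    rw [deriv_fun_sub (hsA.differentiable (by simp) t) (hsB.differentiable (by simp) t),
      hsAd, hsBd]
  have hβi : Integrable β := by
    refine hβc.continuous.integrable_of_hasCompactSupport
      (isCompact_Icc.of_isClosed_subset (isClosed_tsupport _)
        (closure_minimal (hβs.trans Ioo_subset_Icc_self) isClosed_Icc))
  simp only [hder, sub_mul] at key
  rw [integral_sub (hmul A.integrable_normed) (hmul hβi), sub_nonneg] at key
  refine key.trans ?_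
  calc ∫ t, A.normed volume t * D t ≤ ∫ t, A.normed volume t * (D₀ + ε) := by
        refine integral_mono_ae (hmul A.integrable_normed) (A.integrable_normed.mul_const _) ?_
        filter_upwards [hbound] with t ht
        by_cases h0 : A.normed volume t = 0
        · simp [h0]
        · have := hAs h0
          exact mul_le_mul_of_nonneg_left (ht ⟨by linarith [this.1], by linarith [this.2]⟩)
            (A.nonneg_normed t)
    _ = D₀ + ε := by rw [integral_mul_const, A.integral_normed, one_mul]

/-! ### Cone weights -/

/-- Smooth cut-off of the backward cone `√(1+x²) + L t ≤ R`. -/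
noncomputable def coneWeight (L R : ℝ) (z : ℝ × ℝ) : ℝ :=
  Real.smoothTransition (R - √(1 + z.2 ^ 2) - L * z.1)

theorem contDiff_coneWeight (L R : ℝ) : ContDiff ℝ ∞ (coneWeight L R) := by
  have h1 : ContDiff ℝ ∞ fun z : ℝ × ℝ => √(1 + z.2 ^ 2) :=
    ContDiff.sqrt (by fun_prop) fun z => by positivity
  exact Real.smoothTransition.contDiff.comp
    ((contDiff_const.sub h1).sub (contDiff_const.mul contDiff_fst))

theorem coneWeight_nonneg (L R : ℝ) (z : ℝ × ℝ) : 0 ≤ coneWeight L R z :=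
  Real.smoothTransition.nonneg _

theorem coneWeight_le_one (L R : ℝ) (z : ℝ × ℝ) : coneWeight L R z ≤ 1 :=
  Real.smoothTransition.le_one _

theorem coneWeight_eq_zero {L R : ℝ} (hL : 0 ≤ L) {z : ℝ × ℝ} (ht : 0 ≤ z.1)
    (hx : z.2 ∉ Icc (-R) R) : coneWeight L R z = 0 := by
  apply Real.smoothTransition.zero_of_nonpos
  have h1 : R ≤ √(1 + z.2 ^ 2) := by
    have h2 : |z.2| ≤ √(1 + z.2 ^ 2) := Real.abs_le_sqrt (by linarith)
    have h3 : R < |z.2| := by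
      by_contra hc
      exact hx (abs_le.1 (not_lt.1 hc))
    linarith
  nlinarith

/-- Here `d` is the derivative of the transition function, and `√(1+x²)` is a smooth substitute for
`|x|` with slope at most `1`. The decay `L d` in time dominates any flux of speed at most `L`. -/
theorem fderiv_coneWeight (L R : ℝ) (z : ℝ × ℝ) :
    ∃ d ≥ 0, fderiv ℝ (coneWeight L R) z (1, 0) = -(L * d) ∧
      |fderiv ℝ (coneWeight L R) z (0, 1)| ≤ d := by
  have hpos : 0 < 1 + z.2 ^ 2 := by positivity
  have h1 : HasDerivAt (fun x : ℝ => √(1 + x ^ 2)) (2 * z.2 / (2 * √(1 + z.2 ^ 2))) z.2 := by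
    refine HasDerivAt.sqrt ?_ hpos.ne'
    simpa using (hasDerivAt_pow 2 z.2).const_add 1
  have h2 : HasFDerivAt (fun z : ℝ × ℝ => √(1 + z.2 ^ 2))
      ((2 * z.2 / (2 * √(1 + z.2 ^ 2))) • ContinuousLinearMap.snd ℝ ℝ ℝ) z :=
    h1.comp_hasFDerivAt z hasFDerivAt_snd
  have h3 : HasFDerivAt (fun z : ℝ × ℝ => L * z.1) (L • ContinuousLinearMap.fst ℝ ℝ ℝ) z :=
    hasFDerivAt_fst.const_mul L
  have h4 := (h2.const_sub R).sub h3
  have hS : DifferentiableAt ℝ Real.smoothTransition (R - √(1 + z.2 ^ 2) - L * z.1) :=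
    (Real.smoothTransition.contDiff (n := 1)).differentiable (by simp) _
  have h5 : HasFDerivAt (coneWeight L R) _ z := hS.hasDerivAt.comp_hasFDerivAt z h4
  have hd0 : 0 ≤ deriv Real.smoothTransition (R - √(1 + z.2 ^ 2) - L * z.1) :=
    Real.smoothTransition.monotone.deriv_nonneg
  refine ⟨_, hd0, ?_, ?_⟩
  · rw [h5.fderiv]
    simp
    ring
  · rw [h5.fderiv]
    have h6 : |z.2 / √(1 + z.2 ^ 2)| ≤ 1 := by
      rw [abs_div, abs_of_pos (Real.sqrt_pos.2 hpos), div_le_one (Real.sqrt_pos.2 hpos)]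
      exact Real.abs_le_sqrt (by linarith)
    have h7 : 2 * z.2 / (2 * √(1 + z.2 ^ 2)) = z.2 / √(1 + z.2 ^ 2) :=
      mul_div_mul_left _ _ two_ne_zero
    rw [h7]
    simp only [smul_apply, sub_apply, neg_apply, ContinuousLinearMap.coe_snd', ContinuousLinearMap.coe_fst',
      smul_eq_mul, mul_one, mul_zero, sub_zero, abs_mul, abs_neg, abs_of_nonneg hd0]
    exact mul_le_of_le_one_right hd0 h6

theorem coneWeight_tendsto (L : ℝ) (z : ℝ × ℝ) :
    Tendsto (fun n : ℕ => coneWeight L n z) atTop (𝓝 1) := by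
  refine tendsto_const_nhds.congr' ?_
  filter_upwards [tendsto_natCast_atTop_atTop.eventually_ge_atTop
    (1 + √(1 + z.2 ^ 2) + L * z.1)] with n hn
  exact (Real.smoothTransition.one_of_one_le (by linarith)).symm

/-! ### Contraction in `L¹` -/

section Contraction

variable {T L : ℝ} {a b : ℝ × ℝ → ℝ} {G : ℝ → ℝ → ℝ} {Q : ℝ → ℝ} {u w : ℝ × ℝ → ℝ}

/-- The weighted `L¹` distance on a cone is weakly decreasing in time. -/
theorem integral_deriv_mul_coneWeight_nonneg (H : SplitFluxRegular T L a b G Q)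
    (hu : Measurable u) (hu01 : ∀ z, u z ∈ Icc (0 : ℝ) 1)
    (hw : Measurable w) (hw01 : ∀ z, w z ∈ Icc (0 : ℝ) 1)
    (hue : IsEntropySolution T a b G Q u) (hwe : IsEntropySolution T a b G Q w) (R : ℝ)
    {θ : ℝ → ℝ} (hθ : ContDiff ℝ ∞ θ) (hθc : HasCompactSupport θ) (hθs : tsupport θ ⊆ Ioo 0 T)
    (hθ0 : ∀ t, 0 ≤ θ t) :
    Integrable (fun z : ℝ × ℝ => deriv θ z.1 * (|u z - w z| * coneWeight L R z)) ∧
      0 ≤ ∫ z : ℝ × ℝ, deriv θ z.1 * (|u z - w z| * coneWeight L R z) := by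
  have hub := bddMeasurable_of_mem_Icc hu hu01
  have hwb := bddMeasurable_of_mem_Icc hw hw01
  set K : Set (ℝ × ℝ) := tsupport θ ×ˢ Icc (-R) R with hK
  have hKc : IsCompact K := hθc.isCompact.prod isCompact_Icc
  have hout : ∀ z, z ∉ K → z.1 ∉ tsupport θ ∨ coneWeight L R z = 0 := by
    intro z hz
    by_cases h1 : z.1 ∈ tsupport θ
    · exact Or.inr (coneWeight_eq_zero H.nonneg (hθs h1).1.le fun h2 => hz ⟨h1, h2⟩)
    · exact Or.inl h1
  set ψ : ℝ × ℝ → ℝ := fun z => θ z.1 * coneWeight L R z with hψdef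
  have hψ : ContDiff ℝ ∞ ψ := (hθ.comp contDiff_fst).mul (contDiff_coneWeight L R)
  have hψsub : Function.support ψ ⊆ K := by
    intro z hz
    by_contra hc
    rcases hout z hc with h | h
    · exact hz (by simp [hψdef, image_eq_zero_of_notMem_tsupport h])
    · exact hz (by simp [hψdef, h])
  have hts : tsupport ψ ⊆ K := closure_minimal hψsub hKc.isClosed
  have hψc : HasCompactSupport ψ := hKc.of_isClosed_subset (isClosed_tsupport _) hts
  have hkato := kato_inequality H hu hu01 hw hw01 hue hwe hψ hψc
    (fun z hz => ⟨hθs (hts hz).1, mem_univ _⟩)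
    (fun z => mul_nonneg (hθ0 _) (coneWeight_nonneg _ _ _))
  have hfd : ∀ z d, fderiv ℝ ψ z d =
      deriv θ z.1 * d.1 * coneWeight L R z + θ z.1 * fderiv ℝ (coneWeight L R) z d := by
    intro z d
    have h1 : HasFDerivAt (fun z : ℝ × ℝ => θ z.1)
        (deriv θ z.1 • ContinuousLinearMap.fst ℝ ℝ ℝ) z :=
      (hθ.differentiable (by simp) z.1).hasDerivAt.comp_hasFDerivAt z hasFDerivAt_fst
    have h2 := ((contDiff_coneWeight L R).differentiable (by simp) z).hasFDerivAt
    have h3 : HasFDerivAt ψ _ z := h1.mul h2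
    rw [h3.fderiv]
    simp
    ring
  have hint : Integrable fun z : ℝ × ℝ => deriv θ z.1 * (|u z - w z| * coneWeight L R z) := by
    refine BddMeasurable.integrable (s := K) ?_ hKc.measure_lt_top.ne fun z hz => ?_
    · have hd : BddMeasurable (deriv θ) :=
        (hθ.continuous_deriv (by simp)).bddMeasurable_of_hasCompactSupport hθc.deriv
      refine (hd.comp measurable_fst).mul ((hub.sub hwb).abs.mul
        ⟨(contDiff_coneWeight L R).continuous.measurable, 1, fun z => ?_⟩)
      rw [abs_of_nonneg (coneWeight_nonneg _ _ _)]
      exact coneWeight_le_one _ _ _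
    · rcases hout z hz with h | h
      · rw [image_eq_zero_of_notMem_tsupport fun h' => h (tsupport_deriv_subset h'), zero_mul]
      · rw [h, mul_zero, mul_zero]
  refine ⟨hint, hkato.trans (integral_mono_ae ?_ hint (Eventually.of_forall fun z => ?_))⟩
  · refine BddMeasurable.integrable (s := tsupport ψ) ?_ hψc.isCompact.measure_lt_top.ne
      (fun z hz => by simp [fderiv_apply_eq_zero_of_notMem_tsupport hz])
    exact ((hub.sub hwb).abs.mul (bddMeasurable_fderiv_apply hψ hψc _)).add
      (((H.bddMeasurable_flux measurable_id (hu.max hw)).sub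
        (H.bddMeasurable_flux measurable_id (hu.min hw))).mul
        (bddMeasurable_fderiv_apply hψ hψc _))
  · obtain ⟨d, hd0, hdt, hdx⟩ := fderiv_coneWeight L R z
    simp only [hfd, hdt]
    -- The flux term is at most `L |u - w| d`, which the time decay `-L d |u - w|` of the weight
    -- absorbs.
    have hflux : |splitFlux a G Q z (max (u z) (w z)) - splitFlux a G Q z (min (u z) (w z))| ≤
        L * |u z - w z| := by
      refine (H.flux_lip z _ _).trans_eq ?_
      rw [max_sub_min_eq_abs', abs_abs]
    have h1 := abs_mul_le hflux hdx
    have h2 := mul_le_mul_of_nonneg_left ((le_abs_self _).trans h1) (hθ0 z.1)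
    nlinarith

/-- **`L¹` contraction** on a strip. -/
theorem ae_lintegral_sub_le (H : SplitFluxRegular T L a b G Q)
    (hu : Measurable u) (hu01 : ∀ z, u z ∈ Icc (0 : ℝ) 1)
    (hw : Measurable w) (hw01 : ∀ z, w z ∈ Icc (0 : ℝ) 1)
    (hue : IsEntropySolution T a b G Q u) (hwe : IsEntropySolution T a b G Q w) {D₀ : ℝ≥0∞}
    (hnear : ∀ ε > 0, ∃ δ > 0, ∀ᵐ s : ℝ, s ∈ Ioo 0 δ →
      ∫⁻ x, ‖u (s, x) - w (s, x)‖ₑ ≤ D₀ + ENNReal.ofReal ε) :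
    ∀ᵐ t : ℝ, t ∈ Ioo 0 T → ∫⁻ x, ‖u (t, x) - w (t, x)‖ₑ ≤ D₀ := by
  rcases eq_or_ne D₀ ⊤ with rfl | hD₀
  · simp
  have hmeas : ∀ R, Measurable fun z : ℝ × ℝ => |u z - w z| * coneWeight L R z := fun R =>
    (measurable_norm.comp (hu.sub hw)).mul (contDiff_coneWeight L R).continuous.measurable
  have hnn : ∀ R z, 0 ≤ |u z - w z| * coneWeight L R z := fun R z =>
    mul_nonneg (abs_nonneg _) (coneWeight_nonneg _ _ _)
  have hle1 : ∀ z, |u z - w z| ≤ 1 := fun z => by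
    rw [abs_le]
    constructor <;> linarith [(hu01 z).1, (hu01 z).2, (hw01 z).1, (hw01 z).2]
  have hdom : ∀ R : ℝ, ∀ t, 0 < t → ∀ x,
      ‖|u (t, x) - w (t, x)| * coneWeight L R (t, x)‖ ≤ (Icc (-R) R).indicator (fun _ => 1) x := by
    intro R t ht x
    rw [Real.norm_eq_abs, abs_of_nonneg (hnn R _)]
    by_cases hx : x ∈ Icc (-R) R
    · rw [indicator_of_mem hx]
      exact mul_le_one₀ (hle1 _) (coneWeight_nonneg _ _ _) (coneWeight_le_one _ _ _)
    · rw [indicator_of_notMem hx, coneWeight_eq_zero H.nonneg ht.le hx, mul_zero]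
  have hindi : ∀ R : ℝ, Integrable ((Icc (-R) R).indicator fun _ : ℝ => (1 : ℝ)) := fun R =>
    (integrable_indicator_iff measurableSet_Icc).2 (integrableOn_const measure_Icc_lt_top.ne)
  have hslice : ∀ R t, 0 < t →
      Integrable fun x => |u (t, x) - w (t, x)| * coneWeight L R (t, x) := fun R t ht =>
    (hindi R).mono' ((hmeas R).comp measurable_prodMk_left).aestronglyMeasurable
      (Eventually.of_forall (hdom R t ht))
  have hof : ∀ R t, 0 < t → ENNReal.ofReal
      (∫ x, |u (t, x) - w (t, x)| * coneWeight L R (t, x)) =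
      ∫⁻ x, ENNReal.ofReal (|u (t, x) - w (t, x)| * coneWeight L R (t, x)) := fun R t ht =>
    ofReal_integral_eq_lintegral_ofReal (hslice R t ht) (Eventually.of_forall fun x => hnn R _)
  have hbound : ∀ n : ℕ, ∀ᵐ t : ℝ, t ∈ Ioo 0 T →
      ∫ x, |u (t, x) - w (t, x)| * coneWeight L n (t, x) ≤ D₀.toReal := by
    intro n
    -- Negative times are discarded because the cone may widen without bound there, whereas `D` has
    -- to be bounded.
    set D : ℝ → ℝ := (Ioi 0).indicator fun t =>
      ∫ x, |u (t, x) - w (t, x)| * coneWeight L n (t, x) with hD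
    have hDpos : ∀ t, 0 < t → D t = ∫ x, |u (t, x) - w (t, x)| * coneWeight L n (t, x) :=
      fun t ht => indicator_of_mem (s := Ioi (0 : ℝ)) ht _
    have hDb : BddMeasurable D := by
      refine ⟨Measurable.indicator ?_ measurableSet_Ioi,
        ∫ x, (Icc (-(n : ℝ)) n).indicator (fun _ => (1 : ℝ)) x, fun t => ?_⟩
      · exact (StronglyMeasurable.integral_prod_right
          (f := fun t x => |u (t, x) - w (t, x)| * coneWeight L n (t, x))
          (hmeas n).stronglyMeasurable).measurable
      · by_cases ht : 0 < t
        · rw [hDpos t ht]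
          exact norm_integral_le_of_norm_le (hindi n) (Eventually.of_forall (hdom n t ht))
        · have : D t = 0 := indicator_of_notMem (s := Ioi (0 : ℝ)) ht _
          rw [this, abs_zero]
          exact integral_nonneg fun x => indicator_nonneg (fun _ _ => zero_le_one) x
    have := ae_le_of_weakly_decreasing (T := T) (D₀ := D₀.toReal) hDb ?_ ?_
    · filter_upwards [this] with t ht htT
      rw [← hDpos t htT.1]
      exact ht htT
    · intro θ hθ hθc hθs hθ0
      obtain ⟨hi, h0⟩ := integral_deriv_mul_coneWeight_nonneg H hu hu01 hw hw01 hue hwe n hθ hθc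
        hθs hθ0
      rw [Measure.volume_eq_prod, integral_prod _ hi] at h0
      refine h0.trans_eq (integral_congr_ae (Eventually.of_forall fun t => ?_))
      simp only [integral_const_mul]
      by_cases ht : 0 < t
      · rw [hDpos t ht]
      · have : deriv θ t = 0 := image_eq_zero_of_notMem_tsupport fun h' =>
          ht (hθs (tsupport_deriv_subset h')).1
        rw [this, zero_mul, zero_mul]
    · intro ε hε
      obtain ⟨δ, hδ, hae⟩ := hnear ε hε
      refine ⟨δ, hδ, ?_⟩
      filter_upwards [hae] with s hs hsδ
      rw [hDpos s hsδ.1, ← ENNReal.ofReal_le_ofReal_iff (by positivity), hof n s hsδ.1,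
        ENNReal.ofReal_add ENNReal.toReal_nonneg hε.le, ENNReal.ofReal_toReal hD₀]
      refine le_trans (lintegral_mono fun x => ?_) (hs hsδ)
      rw [Real.enorm_eq_ofReal_abs]
      exact ENNReal.ofReal_le_ofReal
        (mul_le_of_le_one_right (abs_nonneg _) (coneWeight_le_one _ _ _))
  filter_upwards [ae_all_iff.2 hbound] with t ht htT
  have hlim : ∀ x, liminf (fun n : ℕ =>
      ENNReal.ofReal (|u (t, x) - w (t, x)| * coneWeight L n (t, x))) atTop =
      ‖u (t, x) - w (t, x)‖ₑ := by
    intro x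
    refine Tendsto.liminf_eq ?_
    rw [Real.enorm_eq_ofReal_abs]
    refine ENNReal.tendsto_ofReal ?_
    simpa using (coneWeight_tendsto L (t, x)).const_mul |u (t, x) - w (t, x)|
  simp only [← hlim]
  -- Fatou's lemma as the cones exhaust the line at the fixed time `t`.
  refine (lintegral_liminf_le (u := atTop) (f := fun (n : ℕ) x =>
    ENNReal.ofReal (|u (t, x) - w (t, x)| * coneWeight L n (t, x))) fun n =>
    ((hmeas n).comp measurable_prodMk_left).ennreal_ofReal).trans ?_
  refine liminf_le_of_frequently_le' (Frequently.of_forall fun n => ?_)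
  change ∫⁻ x, ENNReal.ofReal (|u (t, x) - w (t, x)| * coneWeight L n (t, x)) ≤ D₀
  rw [← hof n t htT.1]
  exact ENNReal.ofReal_le_of_le_toReal (ht n htT)

end Contraction

/-! ### Regularity of the interpolated traffic flux -/

/-- The projection of the line onto `[0,T]`. -/
noncomputable def clampTo (T t : ℝ) : ℝ := max 0 (min t T)

theorem clampTo_mem {T : ℝ} (hT : 0 ≤ T) (t : ℝ) : clampTo T t ∈ Icc 0 T :=
  ⟨le_max_left _ _, max_le hT (min_le_right _ _)⟩

theorem clampTo_of_mem {T t : ℝ} (ht : t ∈ Icc 0 T) : clampTo T t = t := by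
  rw [clampTo, min_eq_left ht.2, max_eq_right ht.1]

theorem lipschitzWith_clampTo (T : ℝ) : LipschitzWith 1 (clampTo T) :=
  (LipschitzWith.id.min_const T).const_max 0

theorem abs_clampTo_sub_le (T t s : ℝ) : |clampTo T t - clampTo T s| ≤ |t - s| := by
  simpa [Real.dist_eq] using (lipschitzWith_clampTo T).dist_le_mul t s

/-- Half of the harmonic mean. -/
noncomputable def halfHarmonicMean (q s : ℝ) : ℝ := q * s / (q + s)

theorem halfHarmonicMean_comm (q s : ℝ) : halfHarmonicMean q s = halfHarmonicMean s q := by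
  rw [halfHarmonicMean, halfHarmonicMean, mul_comm, add_comm]

theorem abs_halfHarmonicMean_le {q s : ℝ} (hq : 0 ≤ q) (hs : 0 ≤ s) :
    |halfHarmonicMean q s| ≤ s := by
  rw [halfHarmonicMean, abs_of_nonneg (by positivity)]
  exact div_le_of_le_mul₀ (by positivity) hs (by nlinarith)

/-- For `s > 0` the difference quotient in `q` is `s² / ((q+s)(q'+s)) ≤ 1`, uniformly down to the
singular point `q = s = 0`. For `s = 0` both values are `0`. -/
theorem abs_halfHarmonicMean_sub_le {q q' s : ℝ} (hq : 0 ≤ q) (hq' : 0 ≤ q') (hs : 0 ≤ s) :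
    |halfHarmonicMean q s - halfHarmonicMean q' s| ≤ |q - q'| := by
  rcases hs.eq_or_lt with rfl | hs
  · simp [halfHarmonicMean]
  · have h1 : 0 < q + s := by positivity
    have h2 : 0 < q' + s := by positivity
    have h3 : halfHarmonicMean q s - halfHarmonicMean q' s =
        s ^ 2 / ((q + s) * (q' + s)) * (q - q') := by
      rw [halfHarmonicMean, halfHarmonicMean]
      field_simp
      ring
    rw [h3, abs_mul, abs_of_nonneg (by positivity)]
    refine mul_le_of_le_one_left (abs_nonneg _) ((div_le_one (by positivity)).2 ?_)
    nlinarith [mul_nonneg hq hq', mul_nonneg hq hs.le, mul_nonneg hq' hs.le]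

theorem abs_halfHarmonicMean_sub_le' {q s s' : ℝ} (hq : 0 ≤ q) (hs : 0 ≤ s) (hs' : 0 ≤ s') :
    |halfHarmonicMean q s - halfHarmonicMean q s'| ≤ |s - s'| := by
  rw [halfHarmonicMean_comm q s, halfHarmonicMean_comm q s']
  exact abs_halfHarmonicMean_sub_le hs hs' hq

/-- The cut-off function along the trajectory, with time restricted to `[0,T]`. -/
noncomputable def movingCutOff (p χ : ℝ → ℝ) (T : ℝ) (z : ℝ × ℝ) : ℝ :=
  χ (z.2 - p (clampTo T z.1))

/-- The space derivative of `movingCutOff`. -/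
noncomputable def movingCutOffDeriv (p χ : ℝ → ℝ) (T : ℝ) (z : ℝ × ℝ) : ℝ :=
  deriv χ (z.2 - p (clampTo T z.1))

/-- The flux `r v(r)`, with the density restricted to `[0,1]`. -/
noncomputable def standardFlux (v : ℝ → ℝ) (r : ℝ) : ℝ := clampTo 1 r * v (clampTo 1 r)

/-- The difference between the flux near the trajectory and the flux away from it. -/
noncomputable def fluxGap (v p : ℝ → ℝ) (T t r : ℝ) : ℝ :=
  2 * (clampTo 1 r * halfHarmonicMean (velocity p (clampTo T t)) (v (clampTo 1 r)))
    - standardFlux v r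

theorem Trajectory.velocity_nonneg_of_nonneg {p : ℝ → ℝ} (hp : Trajectory p) {t : ℝ}
    (ht : 0 ≤ t) : 0 ≤ velocity p t := by
  obtain ⟨K, hK⟩ := hp.lipschitz_velocity
  -- The sign condition becomes an almost everywhere equality of continuous functions, which extends
  -- to every `t ≥ 0`.
  have h1 : (fun t => min (velocity p t) 0) =ᵐ[volume.restrict (Ici 0)] fun _ => 0 := by
    filter_upwards [hp.velocity_nonneg] with s hs
    exact min_eq_right hs
  have h2 := Measure.eqOn_of_ae_eq h1 (ContinuousOn.inf hK.continuousOn continuousOn_const) continuousOn_const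
    (by rw [interior_Ici, closure_Ioi]) ht
  exact min_eq_right_iff.1 h2

theorem Trajectory.hasDerivWithinAt {p : ℝ → ℝ} (hp : Trajectory p) {t : ℝ} (ht : 0 ≤ t) :
    HasDerivWithinAt p (velocity p t) (Ici 0) t :=
  (hp.contDiffOn.differentiableOn (by simp) t ht).hasDerivWithinAt

/-- A Lipschitz `ṗ` may still grow linearly, so the Lipschitz constant of `p` depends on `T`. This
is the reason for clamping time to `[0,T]`. -/
theorem Trajectory.exists_lipschitz {p : ℝ → ℝ} (hp : Trajectory p) {T : ℝ} (hT : 0 ≤ T) :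
    ∃ C : ℝ≥0, ∀ t s, |p (clampTo T t) - p (clampTo T s)| ≤ C * |t - s| := by
  obtain ⟨K, hK⟩ := hp.lipschitz_velocity
  obtain ⟨C, hC⟩ := isCompact_Icc.exists_bound_of_continuousOn
    (hK.continuousOn.mono (Icc_subset_Ici_self : Icc 0 T ⊆ Ici 0))
  have hC0 : 0 ≤ C := (norm_nonneg _).trans (hC 0 ⟨le_rfl, hT⟩)
  refine ⟨⟨C, hC0⟩, fun t s => ?_⟩
  have h1 := (convex_Icc (0 : ℝ) T).norm_image_sub_le_of_norm_hasDerivWithin_le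
    (fun x hx => (hp.hasDerivWithinAt hx.1).mono Icc_subset_Ici_self) hC
    (clampTo_mem hT s) (clampTo_mem hT t)
  exact h1.trans (mul_le_mul_of_nonneg_left (abs_clampTo_sub_le T t s) hC0)

section Regularity

variable {V : ℝ} {v p χ : ℝ → ℝ}

theorem SpeedLaw.exists_lipschitz (hv : SpeedLaw V v) :
    ∃ K : ℝ≥0, ∀ r s, |v (clampTo 1 r) - v (clampTo 1 s)| ≤ K * |r - s| := by
  obtain ⟨K, hK⟩ := hv.lipschitz
  refine ⟨K, fun r s => ?_⟩
  have h1 := hK.dist_le_mul _ (clampTo_mem zero_le_one r) _ (clampTo_mem zero_le_one s)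
  exact h1.trans (mul_le_mul_of_nonneg_left (abs_clampTo_sub_le 1 r s) K.2)

theorem abs_mul_sub_mul_le {x x' m m' V K d : ℝ} (hx : |x - x'| ≤ d) (hm : |m| ≤ V)
    (hx' : |x'| ≤ 1) (hm' : |m - m'| ≤ K * d) : |x * m - x' * m'| ≤ (V + K) * d := by
  have h1 : x * m - x' * m' = (x - x') * m + x' * (m - m') := by ring
  rw [h1]
  refine (abs_add_le _ _).trans ?_
  have h2 := abs_mul_le hx hm
  have h3 := abs_mul_le hx' hm'
  linarith

theorem abs_clampTo_one_le (r : ℝ) : |clampTo 1 r| ≤ 1 := by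
  have := clampTo_mem zero_le_one r
  rw [abs_of_nonneg this.1]
  exact this.2

theorem SpeedLaw.abs_standardFlux_le (hv : SpeedLaw V v) (r : ℝ) : |standardFlux v r| ≤ V := by
  have h := hv.mapsTo (clampTo_mem zero_le_one r)
  have h2 := abs_mul_le (abs_clampTo_one_le r) (abs_of_nonneg h.1 |>.trans_le h.2)
  rwa [one_mul] at h2

theorem abs_fluxGap_le (hv : SpeedLaw V v) (hp : Trajectory p) {T : ℝ} (hT : 0 ≤ T) (t r : ℝ) :
    |fluxGap v p T t r| ≤ 3 * V := by
  have h := hv.mapsTo (clampTo_mem zero_le_one r)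
  have hq := hp.velocity_nonneg_of_nonneg (clampTo_mem hT t).1
  have h1 := abs_mul_le (abs_clampTo_one_le r) ((abs_halfHarmonicMean_le hq h.1).trans h.2)
  have h2 := hv.abs_standardFlux_le r
  rw [fluxGap]
  refine (abs_sub _ _).trans ?_
  rw [abs_mul, abs_two]
  linarith

/-- The interpolated traffic flux is regular in the sense of `SplitFluxRegular`. -/
theorem exists_splitFluxRegular (hv : SpeedLaw V v) (hp : Trajectory p) (hχ : CutOff χ) {T : ℝ}
    (hT : 0 ≤ T) :
    ∃ L, SplitFluxRegular T L (movingCutOff p χ T) (movingCutOffDeriv p χ T) (fluxGap v p T)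
      (standardFlux v) := by
  obtain ⟨Kv, hKv⟩ := hv.exists_lipschitz
  obtain ⟨Kp, hKp⟩ := hp.exists_lipschitz hT
  obtain ⟨Kq, hKq⟩ := hp.lipschitz_velocity
  obtain ⟨Kχ, hKχ⟩ := hχ.contDiff.lipschitzWith_of_hasCompactSupport hχ.hasCompactSupport (by simp)
  have hV : 0 ≤ V := (abs_nonneg _).trans (hv.abs_standardFlux_le 0)
  have hpc : Continuous fun t => p (clampTo T t) := by
    have : LipschitzWith Kp fun t => p (clampTo T t) := LipschitzWith.of_dist_le_mul hKp
    exact this.continuous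
  have hrange := fun r => hv.mapsTo (clampTo_mem zero_le_one r)
  have hvel := fun t => hp.velocity_nonneg_of_nonneg (clampTo_mem hT t).1
  have hQ : ∀ r s, |standardFlux v r - standardFlux v s| ≤ (V + Kv) * |r - s| := fun r s =>
    abs_mul_sub_mul_le (abs_clampTo_sub_le 1 r s)
      (abs_of_nonneg (hrange r).1 |>.trans_le (hrange r).2) (abs_clampTo_one_le s) (hKv r s)
  have hGr : ∀ t r s, |fluxGap v p T t r - fluxGap v p T t s| ≤ 3 * ((V + Kv) * |r - s|) := by
    intro t r s
    have h1 := abs_mul_sub_mul_le (abs_clampTo_sub_le 1 r s)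
      ((abs_halfHarmonicMean_le (hvel t) (hrange r).1).trans (hrange r).2) (abs_clampTo_one_le s)
      ((abs_halfHarmonicMean_sub_le' (hvel t) (hrange r).1 (hrange s).1).trans (hKv r s))
    have h2 := hQ r s
    simp only [fluxGap]
    rw [abs_le] at h1 h2 ⊢
    constructor <;> linarith [h1.1, h1.2, h2.1, h2.2]
  have hGt : ∀ t s r, |fluxGap v p T t r - fluxGap v p T s r| ≤ 2 * (Kq * |t - s|) := by
    intro t s r
    have h1 : |velocity p (clampTo T t) - velocity p (clampTo T s)| ≤ Kq * |t - s| :=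
      (hKq.dist_le_mul _ (clampTo_mem hT t).1 _ (clampTo_mem hT s).1).trans
        (mul_le_mul_of_nonneg_left (abs_clampTo_sub_le T t s) Kq.2)
    have h2 := (abs_halfHarmonicMean_sub_le (hvel t) (hvel s) (hrange r).1).trans h1
    have h3 := abs_mul_le (abs_clampTo_one_le r) h2
    simp only [fluxGap]
    rw [mul_sub, abs_le] at h3
    rw [abs_le]
    constructor <;> linarith [h3.1, h3.2]
  have hχ1 : ∀ x, |χ x| ≤ 1 := fun x => by
    rw [abs_of_nonneg (hχ.mem_Icc x).1]
    exact (hχ.mem_Icc x).2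
  have hGc : Continuous (Function.uncurry (fluxGap v p T)) := by
    refine continuous_iff_continuousAt.2 fun z => ?_
    rw [ContinuousAt, tendsto_iff_norm_sub_tendsto_zero]
    refine squeeze_zero (fun _ => norm_nonneg _) (g := fun z' : ℝ × ℝ =>
      2 * (Kq * |z'.1 - z.1|) + 3 * ((V + Kv) * |z'.2 - z.2|)) (fun z' => ?_) ?_
    · have h1 := hGt z'.1 z.1 z'.2
      have h2 := hGr z.1 z'.2 z.2
      exact (abs_sub_le _ _ _).trans (add_le_add h1 h2)
    · have : Continuous fun z' : ℝ × ℝ =>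
        2 * (Kq * |z'.1 - z.1|) + 3 * ((V + Kv) * |z'.2 - z.2|) := by fun_prop
      simpa using this.tendsto z
  have hQc : Continuous (standardFlux v) := by
    have h0 : 0 ≤ V + Kv := by positivity
    have : LipschitzWith ⟨V + Kv, h0⟩ (standardFlux v) := LipschitzWith.of_dist_le_mul hQ
    exact this.continuous
  have hKv0 := Kv.2
  have hKp0 := Kp.2
  have hKq0 := Kq.2
  have hKχ0 := Kχ.2
  have hprod : 0 ≤ (Kχ * Kp : ℝ) := by positivity
  -- One constant for all bounds: `1` for `|χ|`, `Kχ + Kχ Kp` for the moving cut-off, `2 Kq` for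
  -- `fluxGap` in time. The factor `4` is `3` from `fluxGap` and `1` from `standardFlux`, both in
  -- `r`.
  set L : ℝ := 1 + Kχ + Kχ * Kp + 2 * Kq + 4 * (V + Kv) with hL
  have hL1 : 1 ≤ L := by simp only [NNReal.val_eq_coe] at *; linarith
  have hLχ : (Kχ : ℝ) + Kχ * Kp ≤ L := by simp only [NNReal.val_eq_coe] at *; linarith
  have hLχ' : (Kχ : ℝ) ≤ L := by simp only [NNReal.val_eq_coe] at *; linarith
  have hLq : 2 * (Kq : ℝ) ≤ L := by simp only [NNReal.val_eq_coe] at *; linarith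
  have hLV : 4 * (V + Kv) ≤ L := by simp only [NNReal.val_eq_coe] at *; linarith
  have hLV' : 3 * V ≤ L := by simp only [NNReal.val_eq_coe] at *; linarith
  refine ⟨L, ?_, ?_, ?_, ?_, ?_, hGc, ?_, ?_, hQc, ?_, ?_⟩
  · exact fun z => (hχ1 _).trans hL1
  · intro z z'
    have h1 := hKχ.dist_le_mul (z.2 - p (clampTo T z.1)) (z'.2 - p (clampTo T z'.1))
    rw [Real.dist_eq, Real.dist_eq] at h1
    have h2 : |z.2 - p (clampTo T z.1) - (z'.2 - p (clampTo T z'.1))| ≤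
        |z.2 - z'.2| + Kp * |z.1 - z'.1| := by
      have : z.2 - p (clampTo T z.1) - (z'.2 - p (clampTo T z'.1)) =
        (z.2 - z'.2) - (p (clampTo T z.1) - p (clampTo T z'.1)) := by ring
      rw [this]
      exact (abs_sub _ _).trans (add_le_add le_rfl (hKp _ _))
    calc |movingCutOff p χ T z - movingCutOff p χ T z'|
        ≤ Kχ * (|z.2 - z'.2| + Kp * |z.1 - z'.1|) :=
          h1.trans (mul_le_mul_of_nonneg_left h2 hKχ0)
      _ = Kχ * Kp * |z.1 - z'.1| + Kχ * |z.2 - z'.2| := by ring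
      _ ≤ L * |z.1 - z'.1| + L * |z.2 - z'.2| := by
          refine add_le_add (mul_le_mul_of_nonneg_right ?_ (abs_nonneg _))
            (mul_le_mul_of_nonneg_right hLχ' (abs_nonneg _))
          simp only [NNReal.val_eq_coe] at *; linarith
      _ = L * (|z.1 - z'.1| + |z.2 - z'.2|) := by ring
  · exact fun z => (norm_deriv_le_of_lipschitz hKχ).trans hLχ'
  · exact (hχ.contDiff.continuous_deriv le_rfl).comp
      (continuous_snd.sub (hpc.comp continuous_fst))
  · intro z hz
    have h1 : HasDerivAt (fun t => p (clampTo T t)) (velocity p z.1) z.1 := by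
      refine ((hp.hasDerivWithinAt hz.1.le).hasDerivAt (Ici_mem_nhds hz.1)).congr_of_eventuallyEq ?_
      filter_upwards [Icc_mem_nhds hz.1 hz.2] with t ht
      rw [clampTo_of_mem ht]
    have h2 : HasFDerivAt (fun z : ℝ × ℝ => p (clampTo T z.1))
        (velocity p z.1 • ContinuousLinearMap.fst ℝ ℝ ℝ) z :=
      h1.comp_hasFDerivAt z hasFDerivAt_fst
    have h3 : HasFDerivAt (fun z : ℝ × ℝ => z.2 - p (clampTo T z.1))
        (ContinuousLinearMap.snd ℝ ℝ ℝ - velocity p z.1 • ContinuousLinearMap.fst ℝ ℝ ℝ) z :=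
      hasFDerivAt_snd.sub h2
    have h4 := (hχ.contDiff.differentiable (by simp) (z.2 - p (clampTo T z.1))).hasDerivAt
    refine ⟨_, h4.comp_hasFDerivAt z h3, ?_⟩
    simp [movingCutOffDeriv]
  · exact fun t r => (abs_fluxGap_le hv hp hT t r).trans hLV'
  · intro t s r
    refine (hGt t s r).trans ?_
    rw [← mul_assoc]
    exact mul_le_mul_of_nonneg_right hLq (abs_nonneg _)
  · exact fun r => (hv.abs_standardFlux_le r).trans (by linarith)
  · intro z r s
    have h1 := abs_mul_le (hχ1 (z.2 - p (clampTo T z.1))) (hGr z.1 r s)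
    have h2 := hQ r s
    have h3 : splitFlux (movingCutOff p χ T) (fluxGap v p T) (standardFlux v) z r
        - splitFlux (movingCutOff p χ T) (fluxGap v p T) (standardFlux v) z s =
        movingCutOff p χ T z * (fluxGap v p T z.1 r - fluxGap v p T z.1 s)
          + (standardFlux v r - standardFlux v s) := by simp only [splitFlux]; ring
    rw [h3]
    refine (abs_add_le _ _).trans ((add_le_add h1 h2).trans ?_)
    have h4 := mul_le_mul_of_nonneg_right hLV (abs_nonneg (r - s))
    linarith

/-- On `(0,T) × ℝ` and for densities in `[0,1]`, the traffic flux is the split flux. -/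
theorem flux_eq_splitFlux {T t r : ℝ} (ht : t ∈ Ioo 0 T) (x : ℝ) (hr : r ∈ Icc (0 : ℝ) 1) :
    flux v p χ t x r =
      splitFlux (movingCutOff p χ T) (fluxGap v p T) (standardFlux v) (t, x) r := by
  simp only [flux, speed, splitFlux, movingCutOff, fluxGap, standardFlux, halfHarmonicMean,
    clampTo_of_mem hr, clampTo_of_mem (Ioo_subset_Icc_self ht)]
  -- In the degenerate case `speed` is `0` by definition, and the split formula also vanishes
  -- because `v r = 0`.
  split_ifs with h
  · simp [h.1, h.2]
  · ring

theorem deriv_flux_eq {T t r : ℝ} (ht : t ∈ Ioo 0 T) (x : ℝ) (hr : r ∈ Icc (0 : ℝ) 1) :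
    deriv (fun y => flux v p χ t y r) x = movingCutOffDeriv p χ T (t, x) * fluxGap v p T t r := by
  have h1 : (fun y => flux v p χ t y r) = fun y =>
      χ (y - p (clampTo T t)) * fluxGap v p T t r + standardFlux v r :=
    funext fun y => flux_eq_splitFlux ht y hr
  rw [h1, deriv_add_const, deriv_mul_const_field, deriv_comp_sub_const]
  rfl

end Regularity

/-! ### Stability of Kružkov solutions -/

section Stability

variable {V : ℝ} {v p χ : ℝ → ℝ}

theorem volume_restrict_halfPlane :
    (volume : Measure (ℝ × ℝ)).restrict halfPlane =
      ((volume : Measure ℝ).restrict (Ioi 0)).prod volume := by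
  rw [halfPlane, Measure.volume_eq_prod, ← Measure.prod_restrict, Measure.restrict_univ]

/-- A Kružkov solution has a measurable representative with values in `[0,1]`, which is an entropy
solution on every strip. -/
theorem KruzkovSolution.exists_representative {ρo : ℝ → ℝ} {ρ : ℝ → ℝ → ℝ}
    (hρ : KruzkovSolution v p χ ρo ρ) :
    ∃ u : ℝ × ℝ → ℝ, Measurable u ∧ (∀ z, u z ∈ Icc (0 : ℝ) 1) ∧
      (∀ᵐ z ∂(volume.restrict halfPlane), ρ z.1 z.2 = u z) ∧
      ∀ T, IsEntropySolution T (movingCutOff p χ T) (movingCutOffDeriv p χ T) (fluxGap v p T)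
        (standardFlux v) u := by
  obtain ⟨g, hg, hρg⟩ := hρ.aestronglyMeasurable
  -- The values must lie in `[0,1]` everywhere, since each of them serves as a constant `k` in the
  -- other solution's entropy inequality.
  refine ⟨fun z => clampTo 1 (g z),
    (lipschitzWith_clampTo 1).continuous.measurable.comp hg.measurable,
    fun z => clampTo_mem zero_le_one _, ?_⟩
  have hae : ∀ᵐ z ∂(volume.restrict halfPlane), ρ z.1 z.2 = clampTo 1 (g z) := by
    filter_upwards [hρg, hρ.mem_Icc] with z h1 h2
    rw [← h1, clampTo_of_mem h2]
  refine ⟨hae, fun T k hk φ hφ hφc hφs hφ0 => ?_⟩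
  have hsub : Ioo 0 T ×ˢ (univ : Set ℝ) ⊆ halfPlane := fun z hz => ⟨hz.1.1, mem_univ _⟩
  refine (hρ.entropy k hk φ ⟨hφ, hφc, hφs.trans hsub, hφ0⟩).trans_eq ?_
  refine Eq.trans (integral_congr_ae ?_)
    (setIntegral_eq_integral_of_forall_compl_eq_zero (s := halfPlane) fun z hz => ?_)
  swap
  · have hz' : z ∉ tsupport φ := fun h => hz (hsub (hφs h))
    simp [image_eq_zero_of_notMem_tsupport hz', fderiv_apply_eq_zero_of_notMem_tsupport hz']
  filter_upwards [hae] with z hz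
  by_cases hzT : z ∈ tsupport φ
  · have ht := (hφs hzT).1
    rw [hz, flux_eq_splitFlux ht _ (clampTo_mem zero_le_one _), flux_eq_splitFlux ht _ hk,
      deriv_flux_eq ht _ hk]
  · simp [image_eq_zero_of_notMem_tsupport hzT, fderiv_apply_eq_zero_of_notMem_tsupport hzT]

theorem ae_ae_eq_of_ae_halfPlane {ρ : ℝ → ℝ → ℝ} {u : ℝ × ℝ → ℝ}
    (h : ∀ᵐ z ∂(volume.restrict halfPlane), ρ z.1 z.2 = u z) :
    ∀ᵐ t : ℝ, 0 < t → ∀ᵐ x, ρ t x = u (t, x) := by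
  rw [volume_restrict_halfPlane] at h
  exact (ae_restrict_iff' measurableSet_Ioi).1 (Measure.ae_ae_of_ae_prod h)

/-- The exceptional times are negligible: `E` is null, and by Fubini `u(s,·) = ρ(s,·)` almost
everywhere for almost every `s > 0`. -/
theorem KruzkovSolution.exists_initial_bound {ρo : ℝ → ℝ} {ρ : ℝ → ℝ → ℝ}
    (hρ : KruzkovSolution v p χ ρo ρ) {u : ℝ × ℝ → ℝ}
    (h : ∀ᵐ z ∂(volume.restrict halfPlane), ρ z.1 z.2 = u z) {ε : ℝ} (hε : 0 < ε) :
    ∃ δ > 0, ∀ᵐ s : ℝ, s ∈ Ioo 0 δ →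
      eLpNorm (fun x => u (s, x) - ρo x) 1 volume ≤ ENNReal.ofReal ε := by
  obtain ⟨E, hE, hlim⟩ := hρ.initial
  have h1 := hlim.eventually (ge_mem_nhds (ENNReal.ofReal_pos.2 hε))
  obtain ⟨δ, hδ, hsub⟩ := Metric.mem_nhdsWithin_iff.1 h1
  refine ⟨δ, hδ, ?_⟩
  filter_upwards [ae_ae_eq_of_ae_halfPlane h, compl_mem_ae_iff.2 hE] with s hs hsE hsδ
  have h2 : eLpNorm (fun x => ρ s x - ρo x) 1 volume ≤ ENNReal.ofReal ε := by
    refine hsub ⟨?_, hsδ.1, hsE⟩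
    rw [Metric.mem_ball, Real.dist_eq, sub_zero, abs_of_pos hsδ.1]
    exact hsδ.2
  refine (eLpNorm_congr_ae ?_).trans_le h2
  filter_upwards [hs hsδ.1] with x hx
  rw [hx]

/-- Kružkov solutions form an `L¹` contraction. -/
theorem KruzkovSolution.ae_eLpNorm_sub_le (hv : SpeedLaw V v) (hp : Trajectory p)
    (hχ : CutOff χ) {ρo ρo' : ℝ → ℝ} (ho : Datum ρo) (ho' : Datum ρo') {ρ ρ' : ℝ → ℝ → ℝ}
    (hρ : KruzkovSolution v p χ ρo ρ) (hρ' : KruzkovSolution v p χ ρo' ρ') :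
    ∀ᵐ t ∂(volume.restrict (Ioi (0 : ℝ))),
      eLpNorm (fun x => ρ' t x - ρ t x) 1 volume ≤ eLpNorm (fun x => ρo' x - ρo x) 1 volume := by
  obtain ⟨u, hu, hu01, huρ, hue⟩ := hρ.exists_representative
  obtain ⟨w, hw, hw01, hwρ, hwe⟩ := hρ'.exists_representative
  have hnear : ∀ ε > 0, ∃ δ > 0, ∀ᵐ s : ℝ, s ∈ Ioo 0 δ →
      ∫⁻ x, ‖w (s, x) - u (s, x)‖ₑ ≤
        eLpNorm (fun x => ρo' x - ρo x) 1 volume + ENNReal.ofReal ε := by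
    intro ε hε
    obtain ⟨δ, hδ, hb⟩ := hρ.exists_initial_bound huρ (half_pos hε)
    obtain ⟨δ', hδ', hb'⟩ := hρ'.exists_initial_bound hwρ (half_pos hε)
    refine ⟨min δ δ', lt_min hδ hδ', ?_⟩
    filter_upwards [hb, hb'] with s hs hs' hsδ
    have h1 := hs ⟨hsδ.1, hsδ.2.trans_le (min_le_left _ _)⟩
    have h2 := hs' ⟨hsδ.1, hsδ.2.trans_le (min_le_right _ _)⟩
    have hum : AEStronglyMeasurable (fun x => u (s, x)) volume :=
      (hu.comp measurable_prodMk_left).aestronglyMeasurable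
    have hwm : AEStronglyMeasurable (fun x => w (s, x)) volume :=
      (hw.comp measurable_prodMk_left).aestronglyMeasurable
    rw [← eLpNorm_one_eq_lintegral_enorm]
    -- Triangle inequality through the two data. It is valid even when their distance is infinite.
    have hsplit : (fun x => w (s, x) - u (s, x)) =
        ((fun x => ρo' x - ρo x) + fun x => w (s, x) - ρo' x) - fun x => u (s, x) - ρo x := by
      funext x
      simp only [Pi.add_apply, Pi.sub_apply]
      ring
    have hm1 := ho'.aestronglyMeasurable.sub ho.aestronglyMeasurable
    have hm2 := hwm.sub ho'.aestronglyMeasurable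
    have hm3 := hum.sub ho.aestronglyMeasurable
    calc eLpNorm (fun x => w (s, x) - u (s, x)) 1 volume
        ≤ eLpNorm ((fun x => ρo' x - ρo x) + fun x => w (s, x) - ρo' x) 1 volume
          + eLpNorm (fun x => u (s, x) - ρo x) 1 volume := by
          rw [hsplit]
          exact eLpNorm_sub_le (hm1.add hm2) hm3 le_rfl
      _ ≤ (eLpNorm (fun x => ρo' x - ρo x) 1 volume + ENNReal.ofReal (ε / 2))
          + ENNReal.ofReal (ε / 2) :=
          add_le_add ((eLpNorm_add_le hm1 hm2 le_rfl).trans (add_le_add le_rfl h2)) h1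
      _ = _ := by
          rw [add_assoc, ← ENNReal.ofReal_add (half_pos hε).le (half_pos hε).le, add_halves]
  -- The regularity constant depends on the strip but the contraction bound does not, so countably
  -- many strips cover all times.
  have hstrip : ∀ n : ℕ, ∀ᵐ t : ℝ, t ∈ Ioo 0 (n : ℝ) →
      ∫⁻ x, ‖w (t, x) - u (t, x)‖ₑ ≤ eLpNorm (fun x => ρo' x - ρo x) 1 volume := fun n => by
    obtain ⟨L, hL⟩ := exists_splitFluxRegular hv hp hχ (T := n) n.cast_nonneg
    exact ae_lintegral_sub_le hL hw hw01 hu hu01 (hwe n) (hue n) hnear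
  rw [ae_restrict_iff' measurableSet_Ioi]
  filter_upwards [ae_all_iff.2 hstrip, ae_ae_eq_of_ae_halfPlane huρ,
    ae_ae_eq_of_ae_halfPlane hwρ] with t h1 h2 h3 ht
  obtain ⟨n, hn⟩ := exists_nat_gt t
  refine le_trans ?_ (h1 n ⟨ht, hn⟩)
  rw [← eLpNorm_one_eq_lintegral_enorm]
  refine (eLpNorm_congr_ae ?_).le
  filter_upwards [h2 ht, h3 ht] with x h4 h5
  rw [h4, h5]

theorem l1LipschitzEstimate_of_nonneg (hv : SpeedLaw V v) (hp : Trajectory p) (hχ : CutOff χ)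
    {C : ℝ} (hC : 0 ≤ C) : L1LipschitzEstimate v p χ C := by
  intro ρo ρo' ho ho' ρ ρ' hρ hρ'
  filter_upwards [hρ.ae_eLpNorm_sub_le hv hp hχ ho ho' hρ', ae_restrict_mem measurableSet_Ioi]
    with t h1 ht
  refine h1.trans (le_mul_of_one_le_left (zero_le) ?_)
  rw [← ENNReal.ofReal_one]
  exact ENNReal.ofReal_le_ofReal (Real.one_le_exp (mul_nonneg hC (le_of_lt ht)))

/-- The data cancel pointwise, so their distance is `0` even if they are not integrable. Almost
every time slice then agrees, and Fubini applies to the measurable representatives. -/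
theorem KruzkovSolution.ae_eq (hv : SpeedLaw V v) (hp : Trajectory p) (hχ : CutOff χ)
    {ρo : ℝ → ℝ} (ho : Datum ρo) {ρ₁ ρ₂ : ℝ → ℝ → ℝ}
    (h₁ : KruzkovSolution v p χ ρo ρ₁) (h₂ : KruzkovSolution v p χ ρo ρ₂) :
    ∀ᵐ z ∂(volume.restrict halfPlane), ρ₁ z.1 z.2 = ρ₂ z.1 z.2 := by
  obtain ⟨u, hu, -, huρ, -⟩ := h₁.exists_representative
  obtain ⟨w, hw, -, hwρ, -⟩ := h₂.exists_representative
  have huw : ∀ᵐ z ∂(volume.restrict halfPlane), u z = w z := by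
    rw [volume_restrict_halfPlane,
      Measure.ae_prod_iff_ae_ae (p := fun z => u z = w z) (measurableSet_eq_fun hu hw),
      ae_restrict_iff' measurableSet_Ioi]
    have h0 := (ae_restrict_iff' measurableSet_Ioi).1 (h₁.ae_eLpNorm_sub_le hv hp hχ ho ho h₂)
    filter_upwards [h0, ae_ae_eq_of_ae_halfPlane huρ, ae_ae_eq_of_ae_halfPlane hwρ]
      with t h3 h4 h5 ht
    have h6 : eLpNorm (fun x => w (t, x) - u (t, x)) 1 volume = 0 := by
      refine le_antisymm (le_trans (eLpNorm_congr_ae ?_).le ((h3 ht).trans (by simp))) zero_le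
      filter_upwards [h4 ht, h5 ht] with x hx hx'
      rw [hx, hx']
    have hm : Measurable fun x => w (t, x) - u (t, x) :=
      (hw.comp measurable_prodMk_left).sub (hu.comp measurable_prodMk_left)
    rw [eLpNorm_eq_zero_iff hm.aestronglyMeasurable one_ne_zero] at h6
    filter_upwards [h6] with x hx
    exact (sub_eq_zero.1 hx).symm
  filter_upwards [huρ, hwρ, huw] with z h3 h4 h5
  rw [h3, h4, h5]

end Stability

/-! ### The three assertions. -/

theorem proposition3p4 (V : ℝ) (hV : 0 < V) (v p χ : ℝ → ℝ)
    (hv : SpeedLaw V v) (hp : Trajectory p) (hχ : CutOff χ) :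
    (∀ ρo : ℝ → ℝ, Datum ρo → ∀ ρ₁ ρ₂ : ℝ → ℝ → ℝ,
      KruzkovSolution v p χ ρo ρ₁ → KruzkovSolution v p χ ρo ρ₂ →
      ∀ᵐ z ∂(volume.restrict halfPlane), ρ₁ z.1 z.2 = ρ₂ z.1 z.2) ∧
    (∃ C : ℝ, 0 ≤ C ∧ L1LipschitzEstimate v p χ C) ∧
    (∀ Lχ Lp Lh Lq Lg La : ℝ≥0, LipschitzConstants v p χ Lχ Lp Lh Lq Lg La →
      L1LipschitzEstimate v p χ (stabilityConstant Lχ Lp Lh Lq Lg La)) := by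
  exact ⟨fun _ ho _ _ h₁ h₂ => h₁.ae_eq hv hp hχ ho h₂,
    ⟨0, le_rfl, l1LipschitzEstimate_of_nonneg hv hp hχ le_rfl⟩,
    fun _ _ _ _ _ _ _ => l1LipschitzEstimate_of_nonneg hv hp hχ NNReal.zero_le_coe⟩
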